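/- Let $z\in\mathbb{R}^2$, $\rho>0$, let $B_\rho(z)\subset\mathbb{R}^2$ be the open disc with center $z$ and radius $\rho$, and let $f\in C_c^\infty(B_\rho(z))$ be real-valued (extended by $0$ to $\mathbb{R}^2$). Let $u\in C^2(\mathbb{R}^2\times[0,\infty))$ be the solution of the initial value problem $$(\partial_t^2-\Delta)u(x,t)=0\quad\text{for }(x,t)\in\mathbb{R}^2\times(0,\infty),\qquad u(x,0)=f(x),\quad (\partial_t u)(x,0)=0\quad\text{for }x\in\mathbb{R}^2,$$ where $\Delta$ is the Laplacian in the variable $x$. Then, for every $x\in B_\rho(z)$, $$\int_{\partial B_\rho(z)}\int_{\|x-y\|}^\infty\frac{u(y,t)}{\sqrt{t^2-\|x-y\|^2}}\,dt\,d\sigma(y)=0,$$ where $\|\cdot\|$ is the Euclidean norm and $\sigma$ is the arc length measure on the circle $\partial B_\rho(z)$; here the inner integral converges absolutely for every $y\in\partial B_\rho(z)$ and is a $\sigma$-integrable function of $y$. -/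

import Mathlib

open scoped ContDiff MeasureTheory

/-- `u` is a classical solution of the Cauchy problem for the two-dimensional wave equation
with initial data `(f, g)`: it is twice continuously differentiable on `ℝ² × [0, ∞)`, satisfies
`∂ₜ²u - Δu = 0` on `ℝ² × (0, ∞)` (with `Δ` the Laplacian in the space variable), and
`u(x, 0) = f(x)`, `∂ₜu(x, 0) = g(x)` for every `x`. The values of `u` for `t < 0` play no role. -/
structure IsWaveSolution (f g : EuclideanSpace ℝ (Fin 2) → ℝ)
    (u : EuclideanSpace ℝ (Fin 2) → ℝ → ℝ) : Prop where
  contDiffOn : ContDiffOn ℝ 2 (fun p : EuclideanSpace ℝ (Fin 2) × ℝ => u p.1 p.2)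
    (Set.univ ×ˢ Set.Ici (0 : ℝ))
  wave_eq : ∀ (x : EuclideanSpace ℝ (Fin 2)) (t : ℝ), 0 < t →
    iteratedDeriv 2 (fun s => u x s) t - Laplacian.laplacian (fun y => u y t) x = 0
  initial_value : ∀ x, u x 0 = f x
  initial_velocity : ∀ x, HasDerivWithinAt (fun s => u x s) (g x) (Set.Ici 0) 0

/-- The surface (arc length) measure on the circle `∂B_ρ(z) ⊂ ℝ²`, as a measure on `ℝ²`: the
one-dimensional Hausdorff measure restricted to the circle. -/
noncomputable def circleSurfaceMeasure (z : EuclideanSpace ℝ (Fin 2)) (ρ : ℝ) :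
    MeasureTheory.Measure (EuclideanSpace ℝ (Fin 2)) :=
  (MeasureTheory.Measure.hausdorffMeasure 1).restrict (Metric.sphere z ρ)

open Real Set Filter Topology MeasureTheory

/-! With a = ‖x - y‖, the singular kernel 1/√(t² - a²) is the limit of (2√(t² - a²) - 2√(t² - a² -
ε))/ε as ε → 0⁺, where roots of negative numbers are read as 0. The pairing of u(y,·) with these
milder kernels can be computed in closed form.

By Poisson's formula (`IsWaveSolution.two_pi_mul_eq`), 2πu(y,·) is the time derivative of
`poissonPotential f y`, which is an Abel transform of the circular integrals of f about y.
Integrating by parts produces a composition of two Abel transforms, whose kernel is a logarithm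
(`integral_abelKernel`). In the difference of two kernels everything depending on the time horizon
tends to 0, and what remains is the integral over w of f(w) times log|‖y-w‖² - ‖x-y‖²| - log|‖y-w‖²
- ‖x-y‖² - ε| (`IsWaveSolution.integral_sqrt_sub_sqrt_mul`).

Now integrate over y on the circle. The quadratic terms in y cancel in ‖y-w‖² - ‖x-y‖², so on the
circle this is α - β cos(φ-ψ) with β = 2ρ‖w-x‖. Jensen's formula gives ∫ log|α - β cos φ| dφ = 2π
log(β/2) whenever |α| ≤ β, independently of α (`integral_log_abs_sub_mul_cos_of_le`). For x and w ≠
x in the open disc one has |α| < β, so subtracting a small ε from α changes nothing. For w too close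
to x relative to ε, the difference divided by ε is at most K/‖w-x‖
(`exists_integral_logKernel_sub_bound`), which is locally integrable in the plane. Dominated
convergence makes the averaged regularized pairing tend to 0.

On the circle |u(y,t)| ≤ C/t, and a is bounded below there because x is inside the disc. This gives
absolute convergence of the time integrals and lets the limit ε → 0⁺ pass under both integrals. -/

/-! ### Rotating frame of the plane and parametric double integrals. -/

/-- The unit vector of the plane with polar angle `φ`. -/
noncomputable def unitVec (φ : ℝ) : EuclideanSpace ℝ (Fin 2) := !₂[cos φ, sin φ]

/-- The derivative of `unitVec`. -/
noncomputable def unitVecDeriv (φ : ℝ) : EuclideanSpace ℝ (Fin 2) := !₂[-sin φ, cos φ]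

@[simp] lemma norm_unitVec (φ : ℝ) : ‖unitVec φ‖ = 1 := by
  simp [unitVec, EuclideanSpace.norm_eq]

@[simp] lemma norm_unitVecDeriv (φ : ℝ) : ‖unitVecDeriv φ‖ = 1 := by
  simp [unitVecDeriv, EuclideanSpace.norm_eq]

@[fun_prop] lemma continuous_unitVec : Continuous unitVec := by
  unfold unitVec
  refine (PiLp.continuous_toLp 2 _).comp (continuous_pi fun i => ?_)
  fin_cases i <;> simp <;> fun_prop

@[fun_prop] lemma continuous_unitVecDeriv : Continuous unitVecDeriv := by
  unfold unitVecDeriv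
  refine (PiLp.continuous_toLp 2 _).comp (continuous_pi fun i => ?_)
  fin_cases i <;> simp <;> fun_prop

lemma hasDerivAt_unitVec (φ : ℝ) : HasDerivAt unitVec (unitVecDeriv φ) φ := by
  have h : HasDerivAt (fun φ => ![cos φ, sin φ]) ![-sin φ, cos φ] φ := by
    rw [hasDerivAt_pi]
    intro i
    fin_cases i
    · simpa using hasDerivAt_cos φ
    · simpa using hasDerivAt_sin φ
  exact (PiLp.continuousLinearEquiv 2 ℝ (fun _ : Fin 2 => ℝ)).symm.hasFDerivAt.comp_hasDerivAt φ h

lemma hasDerivAt_unitVecDeriv (φ : ℝ) : HasDerivAt unitVecDeriv (-unitVec φ) φ := by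
  have h : HasDerivAt (fun φ => ![-sin φ, cos φ]) (-![cos φ, sin φ]) φ := by
    rw [hasDerivAt_pi]
    intro i
    fin_cases i
    · simpa using (hasDerivAt_sin φ).fun_neg
    · simpa using hasDerivAt_cos φ
  exact (PiLp.continuousLinearEquiv 2 ℝ (fun _ : Fin 2 => ℝ)).symm.hasFDerivAt.comp_hasDerivAt φ h

lemma unitVec_add_two_pi (φ : ℝ) : unitVec (φ + 2 * π) = unitVec φ := by
  simp [unitVec]

lemma unitVecDeriv_add_two_pi (φ : ℝ) : unitVecDeriv (φ + 2 * π) = unitVecDeriv φ := by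
  simp [unitVecDeriv]

lemma orthonormal_unitVec (φ : ℝ) : Orthonormal ℝ ![unitVec φ, unitVecDeriv φ] := by
  have h : inner ℝ (unitVec φ) (unitVecDeriv φ) = 0 := by
    simp [unitVec, unitVecDeriv, PiLp.inner_apply, Fin.sum_univ_two]
    ring
  rw [orthonormal_iff_ite]
  intro i j
  fin_cases i <;> fin_cases j <;>
    simp [h, real_inner_comm]

/-- The rotated orthonormal frame of the plane. -/
noncomputable def rotatedBasis (φ : ℝ) : OrthonormalBasis (Fin 2) ℝ (EuclideanSpace ℝ (Fin 2)) :=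
  (basisOfOrthonormalOfCardEqFinrank (orthonormal_unitVec φ) (by simp)).toOrthonormalBasis
    (by simpa using orthonormal_unitVec φ)

lemma coe_rotatedBasis (φ : ℝ) : ⇑(rotatedBasis φ) = ![unitVec φ, unitVecDeriv φ] := by
  simp [rotatedBasis]

/-- Swapping two interval integrals of a continuous function. -/
lemma intervalIntegral_swap_of_continuous {F : ℝ → ℝ → ℝ}
    (hF : Continuous fun p : ℝ × ℝ => F p.1 p.2) (a b c d : ℝ) :
    ∫ x in a..b, ∫ y in c..d, F x y = ∫ y in c..d, ∫ x in a..b, F x y := by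
  have key : ∀ c d : ℝ, c ≤ d →
      ∫ x in a..b, ∫ y in c..d, F x y = ∫ y in c..d, ∫ x in a..b, F x y := by
    intro c d hcd
    simp only [intervalIntegral.integral_of_le hcd]
    rw [intervalIntegral_integral_swap]
    rw [Measure.prod_restrict]
    exact (hF.continuousOn.integrableOn_compact
      (isCompact_uIcc.prod isCompact_uIcc : IsCompact (uIcc a b ×ˢ uIcc c d))).mono_set
      (prod_mono uIoc_subset_uIcc (Ioc_subset_Icc_self.trans Icc_subset_uIcc))
  rcases le_total c d with hcd | hcd
  · exact key c d hcd
  · simp only [intervalIntegral.integral_symm d c, intervalIntegral.integral_neg, key d c hcd]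

/-- The increment of a double integral depending on a parameter. -/
lemma integral_integral_sub_eq {G G' : ℝ → ℝ → ℝ → ℝ}
    (hG : Continuous fun p : ℝ × ℝ × ℝ => G p.1 p.2.1 p.2.2)
    (hG' : Continuous fun p : ℝ × ℝ × ℝ => G' p.1 p.2.1 p.2.2)
    (hd : ∀ r θ φ, HasDerivAt (fun r => G r θ φ) (G' r θ φ) r) (a b c d r₀ r₁ : ℝ) :
    (∫ θ in a..b, ∫ φ in c..d, G r₁ θ φ) - (∫ θ in a..b, ∫ φ in c..d, G r₀ θ φ) =
      ∫ r in r₀..r₁, ∫ θ in a..b, ∫ φ in c..d, G' r θ φ := by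
  have hFTC : ∀ θ φ, G r₁ θ φ - G r₀ θ φ = ∫ r in r₀..r₁, G' r θ φ := fun θ φ =>
    (intervalIntegral.integral_eq_sub_of_hasDerivAt (fun r _ => hd r θ φ)
      ((show Continuous fun r => G' r θ φ from
        hG'.comp (by fun_prop : Continuous fun r : ℝ => (r, θ, φ))).intervalIntegrable _ _)).symm
  have hin : ∀ r, Continuous fun θ => ∫ φ in c..d, G r θ φ := fun r =>
    intervalIntegral.continuous_parametric_intervalIntegral_of_continuous'
      (f := fun θ φ => G r θ φ)
      (hG.comp (by fun_prop : Continuous fun p : ℝ × ℝ => (r, p.1, p.2))) c d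
  rw [← intervalIntegral.integral_sub ((hin r₁).intervalIntegrable _ _)
    ((hin r₀).intervalIntegrable _ _),
    intervalIntegral_swap_of_continuous (F := fun r θ => ∫ φ in c..d, G' r θ φ)]
  · refine intervalIntegral.integral_congr fun θ _ => ?_
    have hφ : ∀ r, Continuous fun φ => G r θ φ := fun r =>
      hG.comp (by fun_prop : Continuous fun φ : ℝ => (r, θ, φ))
    rw [← intervalIntegral.integral_sub ((hφ r₁).intervalIntegrable _ _)
      ((hφ r₀).intervalIntegrable _ _),
      intervalIntegral_swap_of_continuous (F := fun r φ => G' r θ φ)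
      (hG'.comp (by fun_prop : Continuous fun p : ℝ × ℝ => (p.1, θ, p.2)))]
    exact intervalIntegral.integral_congr fun φ _ => hFTC θ φ
  · exact intervalIntegral.continuous_parametric_intervalIntegral_of_continuous'
      (f := fun (q : ℝ × ℝ) φ => G' q.1 q.2 φ)
      (hG'.comp (by fun_prop : Continuous fun p : (ℝ × ℝ) × ℝ => (p.1.1, p.1.2, p.2))) c d

/-! ### Spherical means along the backward light cone. -/

section SphericalMeans

variable {U : EuclideanSpace ℝ (Fin 2) × ℝ → ℝ}

lemma continuous_fderiv_fderiv (hU : ContDiff ℝ 2 U) : Continuous (fderiv ℝ (fderiv ℝ U)) :=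
  (hU.fderiv_right (m := 1) (by norm_num)).continuous_fderiv (by norm_num)

lemma hasFDerivAt_fderiv (hU : ContDiff ℝ 2 U) (q : EuclideanSpace ℝ (Fin 2) × ℝ) :
    HasFDerivAt (fderiv ℝ U) (fderiv ℝ (fderiv ℝ U) q) q :=
  ((hU.fderiv_right (m := 1) (by norm_num)).differentiable (by norm_num) q).hasFDerivAt

variable {D : EuclideanSpace ℝ (Fin 2) × ℝ → EuclideanSpace ℝ (Fin 2) × ℝ →L[ℝ] ℝ}
  {H : EuclideanSpace ℝ (Fin 2) × ℝ → EuclideanSpace ℝ (Fin 2) × ℝ →L[ℝ]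
    EuclideanSpace ℝ (Fin 2) × ℝ →L[ℝ] ℝ}

/-- The integrand is the φ-derivative of the tangential derivative D(e_φ'), which is 2π-periodic. -/
lemma integral_angular_derivative (hDc : Continuous D) (hHc : Continuous H)
    (hDd : ∀ q, HasFDerivAt D (H q) q) (y : EuclideanSpace ℝ (Fin 2)) (s t : ℝ) :
    ∫ φ in (0 : ℝ)..(2 * π), (s * H (y + s • unitVec φ, t)
      (unitVecDeriv φ, 0) (unitVecDeriv φ, 0) - D (y + s • unitVec φ, t) (unitVec φ, 0)) = 0 := by
  have hder : ∀ φ, HasDerivAt (fun φ => D (y + s • unitVec φ, t) (unitVecDeriv φ, 0))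
      (s * H (y + s • unitVec φ, t) (unitVecDeriv φ, 0) (unitVecDeriv φ, 0) -
        D (y + s • unitVec φ, t) (unitVec φ, 0)) φ := by
    intro φ
    have h1 : HasDerivAt (fun φ => ((y + s • unitVec φ, t) :
        EuclideanSpace ℝ (Fin 2) × ℝ)) (s • unitVecDeriv φ, 0) φ :=
      (((hasDerivAt_unitVec φ).const_smul s).const_add y).prodMk (hasDerivAt_const _ _)
    have h2 : HasDerivAt (fun φ => ((unitVecDeriv φ, 0) : EuclideanSpace ℝ (Fin 2) × ℝ))
        (-unitVec φ, 0) φ := (hasDerivAt_unitVecDeriv φ).prodMk (hasDerivAt_const _ _)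
    have h3 := ((hDd _).comp_hasDerivAt φ h1).clm_apply h2
    refine h3.congr_deriv ?_
    have e1 : ((s • unitVecDeriv φ, 0) : EuclideanSpace ℝ (Fin 2) × ℝ) =
      s • (unitVecDeriv φ, 0) := by simp
    have e2 : ((-unitVec φ, 0) : EuclideanSpace ℝ (Fin 2) × ℝ) = -(unitVec φ, 0) := by simp
    rw [e1, e2]
    simp only [map_smul, map_neg, FunLike.coe_smul, Pi.smul_apply, smul_eq_mul, Function.comp]
    ring
  rw [intervalIntegral.integral_eq_sub_of_hasDerivAt (fun φ _ => hder φ)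
    (Continuous.intervalIntegrable (by fun_prop) _ _)]
  have h := unitVec_add_two_pi 0
  have h' := unitVecDeriv_add_two_pi 0
  rw [zero_add] at h h'
  rw [h, h', sub_self]

/-- The integrand is the θ-derivative of -sin θ cos θ · D(e), which vanishes at both ends 0 and π/2.
-/
lemma integral_polar_derivative (hDc : Continuous D) (hHc : Continuous H)
    (hDd : ∀ q, HasFDerivAt D (H q) q) (y e : EuclideanSpace ℝ (Fin 2)) (r t : ℝ) :
    ∫ θ in (0 : ℝ)..(π / 2), ((2 * sin θ ^ 2 - 1) * D (y + (r * sin θ) • e, t) (e, 0) -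
      r * sin θ * cos θ ^ 2 * H (y + (r * sin θ) • e, t) (e, 0) (e, 0)) = 0 := by
  have hder : ∀ θ, HasDerivAt (fun θ => -(sin θ * cos θ) * D (y + (r * sin θ) • e, t) (e, 0))
      ((2 * sin θ ^ 2 - 1) * D (y + (r * sin θ) • e, t) (e, 0) -
      r * sin θ * cos θ ^ 2 * H (y + (r * sin θ) • e, t) (e, 0) (e, 0)) θ := by
    intro θ
    have h1 : HasDerivAt (fun θ => ((y + (r * sin θ) • e, t) :
        EuclideanSpace ℝ (Fin 2) × ℝ)) ((r * cos θ) • e, 0) θ :=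
      ((((hasDerivAt_sin θ).const_mul r).smul_const e).const_add y).prodMk (hasDerivAt_const _ _)
    have h2 := ((hDd _).comp_hasDerivAt θ h1).clm_apply (hasDerivAt_const θ
      ((e, 0) : EuclideanSpace ℝ (Fin 2) × ℝ))
    have h3 := (((hasDerivAt_sin θ).mul (hasDerivAt_cos θ)).neg).mul h2
    refine h3.congr_deriv ?_
    have e1 : (((r * cos θ) • e, 0) : EuclideanSpace ℝ (Fin 2) × ℝ) =
      (r * cos θ) • (e, 0) := by simp
    rw [e1]
    simp only [map_smul, map_zero, FunLike.coe_smul, Pi.smul_apply, smul_eq_mul,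
      Function.comp, Pi.mul_apply, Pi.neg_apply]
    linear_combination -(D (y + (r * sin θ) • e, t) (e, 0)) * sin_sq_add_cos_sq θ
  rw [intervalIntegral.integral_eq_sub_of_hasDerivAt (fun θ _ => hder θ)
    (Continuous.intervalIntegrable (by fun_prop) _ _)]
  simp

/-- The wave equation trades the second time derivative for the Laplacian in the frame (e_φ, e_φ').
The integrand then splits into two exact derivatives, one in θ and one in φ. -/
lemma integral_spherical_wave_operator (hDc : Continuous D) (hHc : Continuous H)
    (hDd : ∀ q, HasFDerivAt D (H q) q) (y : EuclideanSpace ℝ (Fin 2)) (r t : ℝ)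
    (hwave : ∀ x φ, H (x, t) (0, 1) (0, 1) =
      H (x, t) (unitVec φ, 0) (unitVec φ, 0) + H (x, t) (unitVecDeriv φ, 0) (unitVecDeriv φ, 0)) :
    ∫ θ in (0 : ℝ)..(π / 2), ∫ φ in (0 : ℝ)..(2 * π), sin θ *
      (2 * D (y + (r * sin θ) • unitVec φ, t) (sin θ • unitVec φ, 0) +
        r * (H (y + (r * sin θ) • unitVec φ, t) (sin θ • unitVec φ, 0) (sin θ • unitVec φ, 0) -
          H (y + (r * sin θ) • unitVec φ, t) (0, 1) (0, 1))) = 0 := by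
  have hsplit : ∀ θ φ, sin θ *
      (2 * D (y + (r * sin θ) • unitVec φ, t) (sin θ • unitVec φ, 0) +
        r * (H (y + (r * sin θ) • unitVec φ, t) (sin θ • unitVec φ, 0) (sin θ • unitVec φ, 0) -
          H (y + (r * sin θ) • unitVec φ, t) (0, 1) (0, 1))) =
      ((2 * sin θ ^ 2 - 1) * D (y + (r * sin θ) • unitVec φ, t) (unitVec φ, 0) -
        r * sin θ * cos θ ^ 2 *
          H (y + (r * sin θ) • unitVec φ, t) (unitVec φ, 0) (unitVec φ, 0)) -
      (r * sin θ * H (y + (r * sin θ) • unitVec φ, t) (unitVecDeriv φ, 0) (unitVecDeriv φ, 0) -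
        D (y + (r * sin θ) • unitVec φ, t) (unitVec φ, 0)) := by
    intro θ φ
    have h1 : ((sin θ • unitVec φ, 0) : EuclideanSpace ℝ (Fin 2) × ℝ) =
        sin θ • (unitVec φ, 0) := by simp
    rw [hwave _ φ, h1]
    simp only [map_smul, FunLike.coe_smul, Pi.smul_apply, smul_eq_mul]
    have h2 : cos θ ^ 2 = 1 - sin θ ^ 2 := by linarith [sin_sq_add_cos_sq θ]
    rw [h2]; ring
  calc _ = ∫ θ in (0 : ℝ)..(π / 2), ∫ φ in (0 : ℝ)..(2 * π),
      ((2 * sin θ ^ 2 - 1) * D (y + (r * sin θ) • unitVec φ, t) (unitVec φ, 0) -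
        r * sin θ * cos θ ^ 2 *
          H (y + (r * sin θ) • unitVec φ, t) (unitVec φ, 0) (unitVec φ, 0)) := by
        refine intervalIntegral.integral_congr fun θ _ => ?_
        simp only [hsplit]
        rw [intervalIntegral.integral_sub (Continuous.intervalIntegrable (by fun_prop) _ _)
          (Continuous.intervalIntegrable (by fun_prop) _ _),
          integral_angular_derivative hDc hHc hDd, sub_zero]
    _ = 0 := by
        rw [intervalIntegral_swap_of_continuous (by fun_prop)]
        simp only [integral_polar_derivative hDc hHc hDd, intervalIntegral.integral_zero]

set_option maxHeartbeats 2000000 in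
/-- The value at `(y, T)` of a solution of the wave equation in terms of
its Cauchy data at time `τ`: averaging over the sphere of `ℝ³` projects to the plane. -/
lemma two_pi_mul_eq_integral_of_contDiff (hU : ContDiff ℝ 2 U) (y : EuclideanSpace ℝ (Fin 2))
    {τ T : ℝ} (hτ : τ ≤ T)
    (hwave : ∀ x t φ, τ ≤ t → fderiv ℝ (fderiv ℝ U) (x, t) (0, 1) (0, 1) =
      fderiv ℝ (fderiv ℝ U) (x, t) (unitVec φ, 0) (unitVec φ, 0) +
      fderiv ℝ (fderiv ℝ U) (x, t) (unitVecDeriv φ, 0) (unitVecDeriv φ, 0)) :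
    2 * π * U (y, T) = ∫ θ in (0 : ℝ)..(π / 2), ∫ φ in (0 : ℝ)..(2 * π), sin θ *
      (U (y + ((T - τ) * sin θ) • unitVec φ, τ) + (T - τ) *
        fderiv ℝ U (y + ((T - τ) * sin θ) • unitVec φ, τ) (sin θ • unitVec φ, 1)) := by
  have hDc : Continuous (fderiv ℝ U) := hU.continuous_fderiv (by norm_num)
  have hHc : Continuous (fderiv ℝ (fderiv ℝ U)) := continuous_fderiv_fderiv hU
  have hUc : Continuous U := hU.continuous
  let q : ℝ → ℝ → ℝ → EuclideanSpace ℝ (Fin 2) × ℝ := fun r θ φ =>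
    (y + (r * sin θ) • unitVec φ, T - r)
  let G : ℝ → ℝ → ℝ → ℝ := fun r θ φ => sin θ *
    (U (q r θ φ) + r * fderiv ℝ U (q r θ φ) (sin θ • unitVec φ, 1))
  let G' : ℝ → ℝ → ℝ → ℝ := fun r θ φ => sin θ *
      (2 * fderiv ℝ U (y + (r * sin θ) • unitVec φ, T - r) (sin θ • unitVec φ, 0) +
        r * (fderiv ℝ (fderiv ℝ U) (y + (r * sin θ) • unitVec φ, T - r)
            (sin θ • unitVec φ, 0) (sin θ • unitVec φ, 0) -
          fderiv ℝ (fderiv ℝ U) (y + (r * sin θ) • unitVec φ, T - r) (0, 1) (0, 1)))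
  have hGc : Continuous fun p : ℝ × ℝ × ℝ => G p.1 p.2.1 p.2.2 := by
    simp only [G, q]; fun_prop
  have hGc' : Continuous fun p : ℝ × ℝ × ℝ => G' p.1 p.2.1 p.2.2 := by
    simp only [G']; fun_prop
  have hd : ∀ r θ φ, HasDerivAt (fun r => G r θ φ) (G' r θ φ) r := by
    intro r θ φ
    have hq : HasDerivAt (fun r => q r θ φ) (sin θ • unitVec φ, -1) r := by
      have := (((((hasDerivAt_id r).mul_const (sin θ)).smul_const (unitVec φ)).const_add y).prodMk
        ((hasDerivAt_id r).const_sub T))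
      simpa [q] using this
    have h1 := ((hU.differentiable (by norm_num) (q r θ φ)).hasFDerivAt).comp_hasDerivAt r hq
    have h2 := ((hasFDerivAt_fderiv hU (q r θ φ)).comp_hasDerivAt r hq).clm_apply
      (hasDerivAt_const r ((sin θ • unitVec φ, 1) : EuclideanSpace ℝ (Fin 2) × ℝ))
    have h3 := (h1.add ((hasDerivAt_id r).mul h2)).const_mul (sin θ)
    refine h3.congr_deriv ?_
    have hsymm : fderiv ℝ (fderiv ℝ U) (q r θ φ) (sin θ • unitVec φ, 0) (0, 1) =
        fderiv ℝ (fderiv ℝ U) (q r θ φ) (0, 1) (sin θ • unitVec φ, 0) :=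
      (hU.contDiffAt.isSymmSndFDerivAt (by simp)) _ _
    have e1 : ((sin θ • unitVec φ, -1) : EuclideanSpace ℝ (Fin 2) × ℝ) =
      (sin θ • unitVec φ, 0) - (0, 1) := by simp
    have e2 : ((sin θ • unitVec φ, 1) : EuclideanSpace ℝ (Fin 2) × ℝ) =
      (sin θ • unitVec φ, 0) + (0, 1) := by simp
    rw [e1, e2]
    simp only [map_add, map_sub, FunLike.coe_sub, Pi.sub_apply, map_zero, G', id,
      Function.comp, hsymm]
    simp only [q]
    ring
  -- The mean over the hemisphere of radius r at time T - r is constant in r: its r-derivative is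
  -- the integral just shown to vanish. This is Kirchhoff's formula for a solution independent of
  -- the third variable.
  have key := integral_integral_sub_eq hGc hGc' hd 0 (π / 2) 0 (2 * π) 0 (T - τ)
  have hzero : ∫ r in (0 : ℝ)..(T - τ), ∫ θ in (0 : ℝ)..(π / 2), ∫ φ in (0 : ℝ)..(2 * π),
      G' r θ φ = 0 := by
    rw [intervalIntegral.integral_congr (g := fun _ => (0 : ℝ))]
    · simp
    · intro r hr
      rw [uIcc_of_le (by linarith)] at hr
      exact integral_spherical_wave_operator hDc hHc (hasFDerivAt_fderiv hU) y r (T - r)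
        fun x φ => hwave x _ φ (by linarith [hr.2])
  rw [hzero, sub_eq_zero] at key
  -- At r = 0 only the hemisphere's area 2π remains.
  have h0 : ∫ θ in (0 : ℝ)..(π / 2), ∫ φ in (0 : ℝ)..(2 * π), G 0 θ φ = 2 * π * U (y, T) := by
    simp [G, q, integral_sin]
  rw [← h0, ← key]
  simp only [G, q, sub_sub_cancel]

end SphericalMeans

/-! ### Poisson's formula for classical solutions. -/

section Representation

lemma iteratedDeriv_two_eq_fderiv_fderiv {U : EuclideanSpace ℝ (Fin 2) × ℝ → ℝ}
    (hU : ContDiff ℝ 2 U) (x : EuclideanSpace ℝ (Fin 2)) (t : ℝ) :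
    iteratedDeriv 2 (fun s => U (x, s)) t = fderiv ℝ (fderiv ℝ U) (x, t) (0, 1) (0, 1) := by
  have hline : ∀ s, HasDerivAt (fun s => ((x, s) : EuclideanSpace ℝ (Fin 2) × ℝ)) (0, 1) s :=
    fun s => (hasDerivAt_const _ _).prodMk (hasDerivAt_id s)
  have h1 : deriv (fun s => U (x, s)) = fun s => fderiv ℝ U (x, s) (0, 1) := by
    ext s
    exact ((hU.differentiable (by norm_num) (x, s)).hasFDerivAt.comp_hasDerivAt s (hline s)).deriv
  rw [iteratedDeriv_succ, iteratedDeriv_one, h1]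
  have h2 := (((hasFDerivAt_fderiv hU (x, t)).comp_hasDerivAt t (hline t)).clm_apply
    (hasDerivAt_const t ((0, 1) : EuclideanSpace ℝ (Fin 2) × ℝ))).deriv
  simpa [Function.comp_def] using h2

lemma laplacian_eq_fderiv_fderiv {U : EuclideanSpace ℝ (Fin 2) × ℝ → ℝ}
    (hU : ContDiff ℝ 2 U) (x : EuclideanSpace ℝ (Fin 2)) (t φ : ℝ) :
    Laplacian.laplacian (fun y => U (y, t)) x =
      fderiv ℝ (fderiv ℝ U) (x, t) (unitVec φ, 0) (unitVec φ, 0) +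
      fderiv ℝ (fderiv ℝ U) (x, t) (unitVecDeriv φ, 0) (unitVecDeriv φ, 0) := by
  have hslice : ∀ y, HasFDerivAt (fun y => ((y, t) : EuclideanSpace ℝ (Fin 2) × ℝ))
      (ContinuousLinearMap.inl ℝ _ ℝ) y := fun y => hasFDerivAt_prodMk_left y t
  have h1 : fderiv ℝ (fun y => U (y, t)) =
      fun y => (fderiv ℝ U (y, t)).comp (ContinuousLinearMap.inl ℝ _ ℝ) := by
    ext1 y
    exact ((hU.differentiable (by norm_num) (y, t)).hasFDerivAt.comp y (hslice y)).fderiv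
  have h2 : ∀ v, iteratedFDeriv ℝ 2 (fun y => U (y, t)) x ![v, v] =
      fderiv ℝ (fderiv ℝ U) (x, t) (v, 0) (v, 0) := by
    intro v
    rw [iteratedFDeriv_two_apply, h1]
    have h3 := ((hasFDerivAt_fderiv hU (x, t)).comp x (hslice x)).clm_comp
      (hasFDerivAt_const (ContinuousLinearMap.inl ℝ (EuclideanSpace ℝ (Fin 2)) ℝ) x)
    have h4 := h3.fderiv
    simp only [Function.comp_def] at h4
    rw [h4]
    simp
  rw [InnerProductSpace.laplacian_eq_iteratedFDeriv_orthonormalBasis _ (rotatedBasis φ)]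
  simp [coe_rotatedBasis, Fin.sum_univ_two, h2]

variable {f g : EuclideanSpace ℝ (Fin 2) → ℝ} {u : EuclideanSpace ℝ (Fin 2) → ℝ → ℝ}

lemma IsWaveSolution.contDiffAt (hu : IsWaveSolution f g u) (x : EuclideanSpace ℝ (Fin 2))
    {t : ℝ} (ht : 0 < t) :
    ContDiffAt ℝ 2 (fun p : EuclideanSpace ℝ (Fin 2) × ℝ => u p.1 p.2) (x, t) :=
  hu.contDiffOn.contDiffAt (prod_mem_nhds univ_mem (Ici_mem_nhds ht))

/-- A wave solution agrees for positive times bounded below with a globally smooth function. -/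
lemma IsWaveSolution.exists_contDiff_eq (hu : IsWaveSolution f g u) {τ : ℝ} (hτ : 0 < τ) :
    ∃ U : EuclideanSpace ℝ (Fin 2) × ℝ → ℝ, ContDiff ℝ 2 U ∧
      ∀ x t, τ ≤ t → U =ᶠ[𝓝 (x, t)] fun p => u p.1 p.2 := by
  -- The cutoff vanishes for t ≤ τ/4 and equals 1 for t ≥ τ/2, so agreement holds in a neighbourhood
  -- of every time t ≥ τ.
  refine ⟨fun p => smoothTransition (4 * p.2 / τ - 1) * u p.1 p.2, ?_, ?_⟩
  · rw [contDiff_iff_contDiffAt]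
    rintro ⟨x, t⟩
    rcases lt_or_ge 0 t with ht | ht
    · refine ContDiffAt.mul ?_ (hu.contDiffAt x ht)
      exact (smoothTransition.contDiff (n := 2)).contDiffAt.comp (x, t) (by fun_prop)
    · have h0 : (fun p : EuclideanSpace ℝ (Fin 2) × ℝ =>
          smoothTransition (4 * p.2 / τ - 1) * u p.1 p.2) =ᶠ[𝓝 (x, t)] fun _ => 0 := by
        have : ∀ᶠ p : EuclideanSpace ℝ (Fin 2) × ℝ in 𝓝 (x, t), p.2 < τ / 4 :=
          continuous_snd.continuousAt.eventually_lt continuousAt_const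
            (show t < τ / 4 by linarith)
        filter_upwards [this] with p hp
        rw [smoothTransition.zero_of_nonpos, zero_mul]
        rw [sub_nonpos, div_le_one hτ]
        linarith
      exact contDiffAt_const.congr_of_eventuallyEq h0
  · intro x t ht
    have : ∀ᶠ p : EuclideanSpace ℝ (Fin 2) × ℝ in 𝓝 (x, t), τ / 2 < p.2 :=
      continuousAt_const.eventually_lt continuous_snd.continuousAt
        (show τ / 2 < t by linarith)
    filter_upwards [this] with p hp
    rw [smoothTransition.one_of_one_le, one_mul]
    rw [le_sub_iff_add_le, le_div_iff₀ hτ]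
    linarith

lemma IsWaveSolution.two_pi_mul_eq_of_pos (hu : IsWaveSolution f g u)
    (y : EuclideanSpace ℝ (Fin 2)) {τ T : ℝ} (hτ : 0 < τ) (hT : τ ≤ T) :
    2 * π * u y T = ∫ θ in (0 : ℝ)..(π / 2), ∫ φ in (0 : ℝ)..(2 * π), sin θ *
      (u (y + ((T - τ) * sin θ) • unitVec φ) τ + (T - τ) *
        fderiv ℝ (fun p : EuclideanSpace ℝ (Fin 2) × ℝ => u p.1 p.2)
          (y + ((T - τ) * sin θ) • unitVec φ, τ) (sin θ • unitVec φ, 1)) := by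
  obtain ⟨U, hU, hUu⟩ := hu.exists_contDiff_eq hτ
  have hval : ∀ x t, τ ≤ t → U (x, t) = u x t := fun x t ht => (hUu x t ht).eq_of_nhds
  rw [← hval y T hT, two_pi_mul_eq_integral_of_contDiff hU y hT]
  · simp only [hval _ τ le_rfl, (hUu _ τ le_rfl).fderiv_eq]
  · intro x t φ ht
    have hw := hu.wave_eq x t (hτ.trans_le ht)
    have e1 : (fun s => u x s) =ᶠ[𝓝 t] fun s => U (x, s) :=
      ((hUu x t ht).comp_tendsto
        (by fun_prop : Continuous fun s : ℝ => (x, s)).continuousAt).symm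
    have e2 : (fun y => u y t) =ᶠ[𝓝 x] fun y => U (y, t) :=
      ((hUu x t ht).comp_tendsto
        (by fun_prop : Continuous fun y : EuclideanSpace ℝ (Fin 2) => (y, t)).continuousAt).symm
    rw [e1.iteratedDeriv_eq, (InnerProductSpace.laplacian_congr_nhds e2).eq_of_nhds,
      iteratedDeriv_two_eq_fderiv_fderiv hU, laplacian_eq_fderiv_fderiv hU x t φ, sub_eq_zero] at hw
    exact hw

lemma uniqueDiffOn_univ_prod_Ici :
    UniqueDiffOn ℝ ((univ : Set (EuclideanSpace ℝ (Fin 2))) ×ˢ Ici (0 : ℝ)) :=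
  uniqueDiffOn_univ.prod (uniqueDiffOn_Ici 0)

lemma IsWaveSolution.continuous_max (hu : IsWaveSolution f g u) :
    Continuous fun p : EuclideanSpace ℝ (Fin 2) × ℝ => u p.1 (max p.2 0) :=
  hu.contDiffOn.continuousOn.comp_continuous
    (by fun_prop : Continuous fun p : EuclideanSpace ℝ (Fin 2) × ℝ => (p.1, max p.2 0))
    (fun p => ⟨mem_univ _, mem_Ici.2 (le_max_right _ _)⟩)

/-- At t = 0 the solution has only a one-sided time derivative. Testing the derivative within the
half space on the directions (0,1) and (v,0) recovers both pieces of Cauchy data. -/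
lemma IsWaveSolution.fderivWithin_initial (hu : IsWaveSolution f g u)
    (x v : EuclideanSpace ℝ (Fin 2)) (c : ℝ) :
    fderivWithin ℝ (fun p : EuclideanSpace ℝ (Fin 2) × ℝ => u p.1 p.2) (univ ×ˢ Ici (0 : ℝ))
      (x, 0) (v, c) = fderiv ℝ f x v + c * g x := by
  set W := fderivWithin ℝ (fun p : EuclideanSpace ℝ (Fin 2) × ℝ => u p.1 p.2)
    (univ ×ˢ Ici (0 : ℝ)) (x, 0) with hW
  have hW' : HasFDerivWithinAt (fun p : EuclideanSpace ℝ (Fin 2) × ℝ => u p.1 p.2) W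
      (univ ×ˢ Ici (0 : ℝ)) (x, 0) :=
    (hu.contDiffOn.differentiableOn (by norm_num) _
      ⟨mem_univ _, mem_Ici.2 le_rfl⟩).hasFDerivWithinAt
  have ht : W (0, 1) = g x := by
    have h1 : HasDerivWithinAt (fun s : ℝ => ((x, s) : EuclideanSpace ℝ (Fin 2) × ℝ)) (0, 1)
        (Ici 0) 0 := ((hasDerivAt_const _ _).prodMk (hasDerivAt_id 0)).hasDerivWithinAt
    have h2 := hW'.comp_hasDerivWithinAt (0 : ℝ) h1 (fun s hs => ⟨mem_univ _, hs⟩)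
    exact (uniqueDiffOn_Ici (0 : ℝ) 0 (mem_Ici.2 le_rfl)).eq_deriv _ h2 (hu.initial_velocity x)
  have hx : W (v, 0) = fderiv ℝ f x v := by
    have h1 : HasFDerivWithinAt (fun y => ((y, 0) : EuclideanSpace ℝ (Fin 2) × ℝ))
        (ContinuousLinearMap.inl ℝ _ ℝ) univ x := (hasFDerivAt_prodMk_left x 0).hasFDerivWithinAt
    have h2 := hW'.comp x h1 (t := univ ×ˢ Ici (0 : ℝ))
      (fun s _ => mk_mem_prod (mem_univ s) (mem_Ici.2 le_rfl))
    rw [hasFDerivWithinAt_univ] at h2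
    have h3 : f = (fun p : EuclideanSpace ℝ (Fin 2) × ℝ => u p.1 p.2) ∘ fun y => (y, 0) := by
      ext y; exact (hu.initial_value y).symm
    rw [h3, h2.fderiv]
    simp
  have : ((v, c) : EuclideanSpace ℝ (Fin 2) × ℝ) = (v, 0) + c • (0, 1) := by simp
  rw [this, map_add, map_smul, hx, ht, smul_eq_mul]

lemma continuous_integral_integral {F : ℝ → ℝ → ℝ → ℝ}
    (hF : Continuous fun p : ℝ × ℝ × ℝ => F p.1 p.2.1 p.2.2) (a b c d : ℝ) :
    Continuous fun τ => ∫ θ in a..b, ∫ φ in c..d, F τ θ φ :=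
  intervalIntegral.continuous_parametric_intervalIntegral_of_continuous'
    (f := fun τ θ => ∫ φ in c..d, F τ θ φ)
    (intervalIntegral.continuous_parametric_intervalIntegral_of_continuous'
      (f := fun (q : ℝ × ℝ) φ => F q.1 q.2 φ)
      (hF.comp (by fun_prop : Continuous fun p : (ℝ × ℝ) × ℝ => (p.1.1, p.1.2, p.2))) _ _) _ _

/-- Writing max τ 0 for the time makes the expression continuous across τ = 0, so Cauchy data at
positive times can be moved to the initial time. -/
lemma continuous_spherical_integral {v : EuclideanSpace ℝ (Fin 2) → ℝ → ℝ}
    {W : EuclideanSpace ℝ (Fin 2) × ℝ → EuclideanSpace ℝ (Fin 2) × ℝ →L[ℝ] ℝ}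
    (hv : Continuous fun p : EuclideanSpace ℝ (Fin 2) × ℝ => v p.1 (max p.2 0))
    (hW : Continuous fun p : EuclideanSpace ℝ (Fin 2) × ℝ => W (p.1, max p.2 0))
    (y : EuclideanSpace ℝ (Fin 2)) (T : ℝ) :
    Continuous fun τ => ∫ θ in (0 : ℝ)..(π / 2), ∫ φ in (0 : ℝ)..(2 * π), sin θ *
      (v (y + ((T - τ) * sin θ) • unitVec φ) (max τ 0) + (T - τ) *
        W (y + ((T - τ) * sin θ) • unitVec φ, max τ 0) (sin θ • unitVec φ, 1)) := by
  refine continuous_integral_integral (F := fun τ θ φ => sin θ *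
      (v (y + ((T - τ) * sin θ) • unitVec φ) (max τ 0) + (T - τ) *
        W (y + ((T - τ) * sin θ) • unitVec φ, max τ 0) (sin θ • unitVec φ, 1))) ?_ _ _ _ _
  have h1 : Continuous fun p : ℝ × ℝ × ℝ =>
      ((y + ((T - p.1) * sin p.2.1) • unitVec p.2.2, p.1) : EuclideanSpace ℝ (Fin 2) × ℝ) := by
    fun_prop
  have h4 : Continuous fun p : ℝ × ℝ × ℝ =>
      ((sin p.2.1 • unitVec p.2.2, 1) : EuclideanSpace ℝ (Fin 2) × ℝ) := by fun_prop
  exact (continuous_sin.comp (continuous_fst.comp continuous_snd)).mul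
    ((hv.comp h1).add ((continuous_const.sub continuous_fst).mul ((hW.comp h1).clm_apply h4)))

/-- Poisson's formula for the wave equation in the plane, in polar coordinates. -/
lemma IsWaveSolution.two_pi_mul_eq (hu : IsWaveSolution f g u)
    (y : EuclideanSpace ℝ (Fin 2)) {T : ℝ} (hT : 0 < T) :
    2 * π * u y T = ∫ θ in (0 : ℝ)..(π / 2), ∫ φ in (0 : ℝ)..(2 * π), sin θ *
      (f (y + (T * sin θ) • unitVec φ) + T * (sin θ *
        fderiv ℝ f (y + (T * sin θ) • unitVec φ) (unitVec φ) +
          g (y + (T * sin θ) • unitVec φ))) := by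
  set W := fderivWithin ℝ (fun p : EuclideanSpace ℝ (Fin 2) × ℝ => u p.1 p.2)
    (univ ×ˢ Ici (0 : ℝ)) with hW
  have hWc : Continuous fun p : EuclideanSpace ℝ (Fin 2) × ℝ => W (p.1, max p.2 0) :=
    (hu.contDiffOn.continuousOn_fderivWithin uniqueDiffOn_univ_prod_Ici
      (by norm_num)).comp_continuous
      (by fun_prop : Continuous fun p : EuclideanSpace ℝ (Fin 2) × ℝ => (p.1, max p.2 0))
      (fun p => ⟨mem_univ _, mem_Ici.2 (le_max_right _ _)⟩)
  have hI := continuous_spherical_integral hu.continuous_max hWc y T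
  have hzero : ∫ θ in (0 : ℝ)..(π / 2), ∫ φ in (0 : ℝ)..(2 * π), sin θ *
      (u (y + ((T - 0) * sin θ) • unitVec φ) (max 0 0) + (T - 0) *
        W (y + ((T - 0) * sin θ) • unitVec φ, max 0 0) (sin θ • unitVec φ, 1)) =
      ∫ θ in (0 : ℝ)..(π / 2), ∫ φ in (0 : ℝ)..(2 * π), sin θ *
      (f (y + (T * sin θ) • unitVec φ) + T * (sin θ *
        fderiv ℝ f (y + (T * sin θ) • unitVec φ) (unitVec φ) +
          g (y + (T * sin θ) • unitVec φ))) := by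
    simp only [max_self, sub_zero, hu.initial_value, hW, hu.fderivWithin_initial, map_smul,
      smul_eq_mul, one_mul]
  have hpos : ∀ τ ∈ Ioc 0 T, ∫ θ in (0 : ℝ)..(π / 2), ∫ φ in (0 : ℝ)..(2 * π), sin θ *
      (u (y + ((T - τ) * sin θ) • unitVec φ) (max τ 0) + (T - τ) *
        W (y + ((T - τ) * sin θ) • unitVec φ, max τ 0) (sin θ • unitVec φ, 1)) =
      2 * π * u y T := by
    intro τ hτ
    rw [hu.two_pi_mul_eq_of_pos y hτ.1 hτ.2]
    have e : ∀ x, W (x, τ) =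
        fderiv ℝ (fun p : EuclideanSpace ℝ (Fin 2) × ℝ => u p.1 p.2) (x, τ) := fun x =>
      fderivWithin_of_mem_nhds (prod_mem_nhds univ_mem (Ici_mem_nhds hτ.1))
    simp only [max_eq_left hτ.1.le, e]
  rw [← hzero]
  -- The representation from time τ has the same value for all τ in (0, T]; let τ → 0⁺.
  refine tendsto_nhds_unique (tendsto_const_nhds.congr' ?_)
    ((hI.tendsto 0).mono_left (nhdsWithin_le_nhds (s := Ioi 0)))
  filter_upwards [Ioc_mem_nhdsGT hT] with τ hτ using (hpos τ hτ).symm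

end Representation

/-! ### The time primitive of the wave, decay bounds, and its Abel transform form. -/

section Potential

/-- The integral of `f` over the circle of radius `s` about `y`, with respect to the angle. -/
noncomputable def angularIntegral (f : EuclideanSpace ℝ (Fin 2) → ℝ)
    (y : EuclideanSpace ℝ (Fin 2)) (s : ℝ) : ℝ :=
  ∫ φ in (0 : ℝ)..(2 * π), f (y + s • unitVec φ)

/-- `2π` times the solution of the wave equation with initial data `(0, f)`. -/
noncomputable def poissonPotential (f : EuclideanSpace ℝ (Fin 2) → ℝ)
    (y : EuclideanSpace ℝ (Fin 2)) (t : ℝ) : ℝ :=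
  ∫ θ in (0 : ℝ)..(π / 2), ∫ φ in (0 : ℝ)..(2 * π),
    t * sin θ * f (y + (t * sin θ) • unitVec φ)

variable {f : EuclideanSpace ℝ (Fin 2) → ℝ} {u : EuclideanSpace ℝ (Fin 2) → ℝ → ℝ}

lemma continuous_angularIntegral_uncurry (hf : Continuous f) :
    Continuous fun p : EuclideanSpace ℝ (Fin 2) × ℝ => angularIntegral f p.1 p.2 :=
  intervalIntegral.continuous_parametric_intervalIntegral_of_continuous'
    (f := fun (p : EuclideanSpace ℝ (Fin 2) × ℝ) φ => f (p.1 + p.2 • unitVec φ))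
    (by fun_prop) 0 (2 * π)

lemma continuous_angularIntegral (hf : Continuous f) (y : EuclideanSpace ℝ (Fin 2)) :
    Continuous (angularIntegral f y) :=
  (continuous_angularIntegral_uncurry hf).comp (by fun_prop : Continuous fun s : ℝ => (y, s))

/-- Differentiating the potential under the integral sign gives exactly the right side of Poisson's
formula with zero initial velocity. -/
lemma IsWaveSolution.hasDerivAt_poissonPotential (hf : ContDiff ℝ ∞ f)
    (hu : IsWaveSolution f (fun _ => 0) u) (y : EuclideanSpace ℝ (Fin 2)) {t : ℝ} (ht : 0 < t) :
    HasDerivAt (poissonPotential f y) (2 * π * u y t) t := by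
  have hfc : Continuous f := hf.continuous
  have hDc : Continuous (fderiv ℝ f) := hf.continuous_fderiv (by simp)
  let G : ℝ → ℝ → ℝ → ℝ := fun t θ φ => t * sin θ * f (y + (t * sin θ) • unitVec φ)
  let G' : ℝ → ℝ → ℝ → ℝ := fun t θ φ => sin θ *
      (f (y + (t * sin θ) • unitVec φ) + t * (sin θ *
        fderiv ℝ f (y + (t * sin θ) • unitVec φ) (unitVec φ) + 0))
  have hG : Continuous fun p : ℝ × ℝ × ℝ => G p.1 p.2.1 p.2.2 := by simp only [G]; fun_prop
  have hG' : Continuous fun p : ℝ × ℝ × ℝ => G' p.1 p.2.1 p.2.2 := by simp only [G']; fun_prop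
  have hd : ∀ t θ φ, HasDerivAt (fun t => G t θ φ) (G' t θ φ) t := by
    intro t θ φ
    have h0 : HasDerivAt (fun t => t * sin θ) (sin θ) t := by
      simpa using (hasDerivAt_id t).mul_const (sin θ)
    have h1 : HasDerivAt (fun t => y + (t * sin θ) • unitVec φ) (sin θ • unitVec φ) t :=
      (h0.smul_const (unitVec φ)).const_add y
    have h2 := (hf.differentiable (by simp)
      (y + (t * sin θ) • unitVec φ)).hasFDerivAt.comp_hasDerivAt t h1
    refine (h0.mul h2).congr_deriv ?_
    simp only [Function.comp, map_smul, smul_eq_mul, G']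
    ring
  have hI := continuous_integral_integral hG' 0 (π / 2) 0 (2 * π)
  have hV : poissonPotential f y = fun t => poissonPotential f y 0 +
      ∫ r in (0 : ℝ)..t, ∫ θ in (0 : ℝ)..(π / 2), ∫ φ in (0 : ℝ)..(2 * π), G' r θ φ := by
    ext t
    rw [← integral_integral_sub_eq hG hG' hd 0 (π / 2) 0 (2 * π) 0 t]
    simp [poissonPotential, G]
  rw [hV, hu.two_pi_mul_eq y ht]
  exact (hI.integral_hasStrictDerivAt 0 t).hasDerivAt.const_add _

/-- Only angles with t sin θ ≤ R see the support of f, and there sin θ ≤ R/t; this is where the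
decay in t comes from. The factor π² is the measure (π/2)(2π) of the parameter rectangle. -/
lemma IsWaveSolution.abs_le_div (hu : IsWaveSolution f (fun _ => 0) u) {M₀ M₁ R : ℝ} (hR : 0 ≤ R)
    (hM₀ : ∀ w, |f w| ≤ M₀) (hM₁ : ∀ w, ‖fderiv ℝ f w‖ ≤ M₁)
    (y : EuclideanSpace ℝ (Fin 2)) (hy : ∀ s φ, R < s → y + s • unitVec φ ∉ tsupport f)
    {t : ℝ} (ht : 0 < t) :
    |2 * π * u y t| ≤ π ^ 2 * (R * (M₀ + R * M₁)) / t := by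
  have hM₀' : 0 ≤ M₀ := (abs_nonneg _).trans (hM₀ 0)
  have hM₁' : 0 ≤ M₁ := (norm_nonneg _).trans (hM₁ 0)
  rw [hu.two_pi_mul_eq y ht, ← Real.norm_eq_abs]
  have hpt : ∀ θ ∈ uIoc 0 (π / 2), ∀ φ, ‖sin θ *
      (f (y + (t * sin θ) • unitVec φ) + t * (sin θ *
        fderiv ℝ f (y + (t * sin θ) • unitVec φ) (unitVec φ) + 0))‖ ≤
      R * (M₀ + R * M₁) / t := by
    intro θ hθ φ
    rw [uIoc_of_le (by positivity)] at hθ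
    have hs : 0 ≤ sin θ := sin_nonneg_of_nonneg_of_le_pi hθ.1.le (by linarith [hθ.2, pi_pos])
    rcases le_or_gt (t * sin θ) R with h | h
    · have e : sin θ * (f (y + (t * sin θ) • unitVec φ) + t * (sin θ *
        fderiv ℝ f (y + (t * sin θ) • unitVec φ) (unitVec φ) + 0)) =
        (t * sin θ) * (f (y + (t * sin θ) • unitVec φ) + (t * sin θ) *
        fderiv ℝ f (y + (t * sin θ) • unitVec φ) (unitVec φ)) / t := by
        field_simp
        ring
      rw [e, norm_div, norm_mul, Real.norm_of_nonneg ht.le,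
        Real.norm_of_nonneg (by positivity : 0 ≤ t * sin θ)]
      gcongr
      refine (norm_add_le _ _).trans (add_le_add (hM₀ _) ?_)
      rw [norm_mul, Real.norm_of_nonneg (by positivity : 0 ≤ t * sin θ)]
      gcongr
      refine ((fderiv ℝ f _).le_opNorm _).trans ?_
      rw [norm_unitVec, mul_one]
      exact hM₁ _
    · have h1 := hy _ φ h
      rw [image_eq_zero_of_notMem_tsupport h1,
        fderiv_of_notMem_tsupport ℝ h1]
      simp
      positivity
  have h2 : ∀ θ ∈ uIoc 0 (π / 2), ‖∫ φ in (0 : ℝ)..(2 * π), sin θ *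
      (f (y + (t * sin θ) • unitVec φ) + t * (sin θ *
        fderiv ℝ f (y + (t * sin θ) • unitVec φ) (unitVec φ) + 0))‖ ≤
      R * (M₀ + R * M₁) / t * |2 * π - 0| := fun θ hθ =>
    intervalIntegral.norm_integral_le_of_norm_le_const fun φ _ => hpt θ hθ φ
  refine (intervalIntegral.norm_integral_le_of_norm_le_const h2).trans (le_of_eq ?_)
  rw [sub_zero, sub_zero, abs_of_pos (by positivity), abs_of_pos (by positivity)]
  field_simp

lemma abs_poissonPotential_le {M₀ R : ℝ} (hR : 0 ≤ R) (hM₀ : ∀ w, |f w| ≤ M₀)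
    (y : EuclideanSpace ℝ (Fin 2)) (hy : ∀ s φ, R < s → y + s • unitVec φ ∉ tsupport f)
    {t : ℝ} (ht : 0 < t) :
    |poissonPotential f y t| ≤ π ^ 2 * (R * M₀) := by
  have hM₀' : 0 ≤ M₀ := (abs_nonneg _).trans (hM₀ 0)
  have hpt : ∀ θ ∈ uIoc 0 (π / 2), ∀ φ, ‖t * sin θ * f (y + (t * sin θ) • unitVec φ)‖ ≤
      R * M₀ := by
    intro θ hθ φ
    rw [uIoc_of_le (by positivity)] at hθ
    have hs : 0 ≤ sin θ := sin_nonneg_of_nonneg_of_le_pi hθ.1.le (by linarith [hθ.2, pi_pos])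
    rcases le_or_gt (t * sin θ) R with h | h
    · rw [norm_mul, Real.norm_of_nonneg (by positivity : 0 ≤ t * sin θ)]
      gcongr
      exact hM₀ _
    · rw [image_eq_zero_of_notMem_tsupport (hy _ φ h)]
      simp
      positivity
  have h2 : ∀ θ ∈ uIoc 0 (π / 2), ‖∫ φ in (0 : ℝ)..(2 * π),
      t * sin θ * f (y + (t * sin θ) • unitVec φ)‖ ≤ R * M₀ * |2 * π - 0| := fun θ hθ =>
    intervalIntegral.norm_integral_le_of_norm_le_const fun φ _ => hpt θ hθ φ
  refine (intervalIntegral.norm_integral_le_of_norm_le_const h2).trans (le_of_eq ?_)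
  rw [sub_zero, sub_zero, abs_of_pos (by positivity), abs_of_pos (by positivity)]
  ring

lemma image_mul_sin_Ioo {t : ℝ} (ht : 0 < t) :
    (fun θ => t * sin θ) '' Ioo 0 (π / 2) = Ioo 0 t := by
  ext s
  constructor
  · rintro ⟨θ, hθ, rfl⟩
    refine ⟨mul_pos ht (sin_pos_of_pos_of_lt_pi hθ.1 (by linarith [hθ.2, pi_pos])), ?_⟩
    have : sin θ < 1 := by
      rw [← sin_pi_div_two]
      exact sin_lt_sin_of_lt_of_le_pi_div_two (by linarith [hθ.1, pi_pos]) le_rfl hθ.2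
    show t * sin θ < t
    nlinarith
  · intro hs
    have h1 : s / t < 1 := (div_lt_one ht).2 hs.2
    have h0 : 0 < s / t := div_pos hs.1 ht
    refine ⟨arcsin (s / t), ⟨arcsin_pos.2 h0, arcsin_lt_pi_div_two.2 h1⟩, ?_⟩
    show t * sin (arcsin (s / t)) = s
    rw [sin_arcsin (by linarith) h1.le]
    field_simp

/-- Substitute s = t sin θ, for which t cos θ = √(t² - s²). -/
lemma poissonPotential_eq (f : EuclideanSpace ℝ (Fin 2) → ℝ)
    (y : EuclideanSpace ℝ (Fin 2)) {t : ℝ} (ht : 0 < t) :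
    poissonPotential f y t = ∫ s in Ioc 0 t, s * angularIntegral f y s / √(t ^ 2 - s ^ 2) := by
  rw [integral_Ioc_eq_integral_Ioo, ← image_mul_sin_Ioo ht,
    integral_image_eq_integral_abs_deriv_smul (f' := fun θ => t * cos θ) measurableSet_Ioo
      (fun θ _ => ((hasDerivAt_sin θ).const_mul t).hasDerivWithinAt)
      (fun a ha b hb hab => injOn_sin ⟨by linarith [ha.1, pi_pos], ha.2.le⟩
        ⟨by linarith [hb.1, pi_pos], hb.2.le⟩ (mul_left_cancel₀ ht.ne' hab)),
    poissonPotential, intervalIntegral.integral_of_le (by positivity),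
    integral_Ioc_eq_integral_Ioo]
  refine setIntegral_congr_fun measurableSet_Ioo fun θ hθ => ?_
  have hc : 0 < cos θ := cos_pos_of_mem_Ioo ⟨by linarith [hθ.1, pi_pos], hθ.2⟩
  have hsq : √(t ^ 2 - (t * sin θ) ^ 2) = t * cos θ := by
    rw [show t ^ 2 - (t * sin θ) ^ 2 = (t * cos θ) ^ 2 by
      linear_combination -t ^ 2 * sin_sq_add_cos_sq θ]
    exact sqrt_sq (by positivity)
  simp only [smul_eq_mul, hsq, abs_of_pos (mul_pos ht hc), angularIntegral,
    intervalIntegral.integral_const_mul]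
  field_simp

end Potential

/-! ### Products of Abel kernels and their logarithmic integral. -/

section AbelKernel

lemma sq_lt_sq_of_nonneg {a t : ℝ} (ha : 0 ≤ a) (h : a < t) : 0 < t ^ 2 - a ^ 2 := by
  nlinarith

lemma hasDerivAt_sqrt_sq_sub {a t : ℝ} (h : 0 < t ^ 2 - a ^ 2) :
    HasDerivAt (fun t => √(t ^ 2 - a ^ 2)) (t / √(t ^ 2 - a ^ 2)) t := by
  have h1 : HasDerivAt (fun t : ℝ => t ^ 2 - a ^ 2) (2 * t) t := by
    simpa using (hasDerivAt_pow 2 t).sub_const (a ^ 2)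
  refine (h1.sqrt h.ne').congr_deriv ?_
  field_simp

lemma hasDerivAt_log_sqrt_add_sqrt {a b t : ℝ} (ha : 0 < t ^ 2 - a ^ 2) (hb : 0 < t ^ 2 - b ^ 2) :
    HasDerivAt (fun t => 2 * log (√(t ^ 2 - a ^ 2) + √(t ^ 2 - b ^ 2)))
      (2 * t / (√(t ^ 2 - a ^ 2) * √(t ^ 2 - b ^ 2))) t := by
  have hA := sqrt_pos.2 ha
  have hB := sqrt_pos.2 hb
  refine ((((hasDerivAt_sqrt_sq_sub ha).add (hasDerivAt_sqrt_sq_sub hb)).log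
    (add_pos hA hB).ne').const_mul 2).congr_deriv ?_
  simp only [Pi.add_apply]
  field_simp
  ring

/-- The real square root is 0 on negative numbers and division by 0 gives 0, so the kernel truncates
itself and integrals can all be taken over (0, T]. -/
lemma abelKernel_eq_zero {a b t : ℝ} (ht : 0 ≤ t) (h : t ≤ max a b) :
    2 * t / (√(t ^ 2 - a ^ 2) * √(t ^ 2 - b ^ 2)) = 0 := by
  rcases le_max_iff.1 h with h | h
  · rw [sqrt_eq_zero_of_nonpos (by nlinarith : t ^ 2 - a ^ 2 ≤ 0)]; simp
  · rw [sqrt_eq_zero_of_nonpos (by nlinarith : t ^ 2 - b ^ 2 ≤ 0)]; simp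

/-- The integral of the product of two Abel kernels. -/
lemma integral_abelKernel {a b T : ℝ} (ha : 0 ≤ a) (hb : 0 ≤ b) (hab : a ≠ b)
    (hT : max a b ≤ T) :
    IntegrableOn (fun t => 2 * t / (√(t ^ 2 - a ^ 2) * √(t ^ 2 - b ^ 2))) (Ioc 0 T) ∧
    ∫ t in Ioc 0 T, 2 * t / (√(t ^ 2 - a ^ 2) * √(t ^ 2 - b ^ 2)) =
      2 * log (√(T ^ 2 - a ^ 2) + √(T ^ 2 - b ^ 2)) - log |a ^ 2 - b ^ 2| := by
  wlog h : a < b generalizing a b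
  · have := this hb ha hab.symm (by rwa [max_comm]) (lt_of_le_of_ne (not_lt.1 h) hab.symm)
    simpa only [mul_comm (√(_ ^ 2 - b ^ 2)), add_comm (√(_ ^ 2 - b ^ 2)), abs_sub_comm (b ^ 2)]
      using this
  rw [max_eq_right h.le] at hT
  set k : ℝ → ℝ := fun t => 2 * t / (√(t ^ 2 - a ^ 2) * √(t ^ 2 - b ^ 2)) with hk
  have hcont : ContinuousOn (fun t => 2 * log (√(t ^ 2 - a ^ 2) + √(t ^ 2 - b ^ 2)))
      (Icc b T) := by
    refine continuousOn_const.mul (ContinuousOn.log (by fun_prop) fun t ht => ?_)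
    have := sqrt_pos.2 (sq_lt_sq_of_nonneg ha (h.trans_le ht.1))
    positivity
  have hder : ∀ t ∈ Ioo b T, HasDerivAt
      (fun t => 2 * log (√(t ^ 2 - a ^ 2) + √(t ^ 2 - b ^ 2))) (k t) t := fun t ht =>
    hasDerivAt_log_sqrt_add_sqrt (sq_lt_sq_of_nonneg ha (h.trans ht.1))
      (sq_lt_sq_of_nonneg hb ht.1)
  have hint : IntegrableOn k (Ioc b T) :=
    intervalIntegral.integrableOn_deriv_of_nonneg hcont hder fun t ht => by
      have := hb.trans_lt ht.1
      simp only [hk]; positivity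
  have hzero : ∀ t ∈ Ioc 0 b, k t = 0 := fun t ht =>
    abelKernel_eq_zero ht.1.le (ht.2.trans (le_max_right _ _))
  have hint0 : IntegrableOn k (Ioc 0 b) :=
    (integrableOn_zero (ε' := ℝ)).congr_fun (fun t ht => (hzero t ht).symm) measurableSet_Ioc
  have hunion : Ioc 0 T = Ioc 0 b ∪ Ioc b T := (Ioc_union_Ioc_eq_Ioc hb hT).symm
  refine ⟨hunion ▸ hint0.union hint, ?_⟩
  rw [hunion, setIntegral_union (Ioc_disjoint_Ioc_of_le le_rfl) measurableSet_Ioc hint0 hint,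
    setIntegral_congr_fun measurableSet_Ioc hzero, integral_zero, zero_add,
    ← intervalIntegral.integral_of_le hT,
    intervalIntegral.integral_eq_sub_of_hasDerivAt_of_le hT hcont hder
      ((intervalIntegrable_iff_integrableOn_Ioc_of_le hT).2 hint)]
  -- At the lower limit t = b one root vanishes, and 2 log √(b² - a²) = log(b² - a²).
  have hpos := sq_lt_sq_of_nonneg ha h
  rw [sub_self, sqrt_zero, add_zero, log_sqrt hpos.le, abs_sub_comm, abs_of_pos hpos]
  ring

lemma intervalIntegrable_log_abs_sq_sub (a c d : ℝ) :
    IntervalIntegrable (fun s => log |s ^ 2 - a ^ 2|) volume c d := by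
  have h1 : IntervalIntegrable (fun s => log (s - a)) volume c d := by
    simpa using (intervalIntegral.intervalIntegrable_log' (a := c - a)
      (b := d - a)).comp_sub_right a
  have h2 : IntervalIntegrable (fun s => log (s + a)) volume c d := by
    simpa using (intervalIntegral.intervalIntegrable_log' (a := c + a)
      (b := d + a)).comp_add_right a
  refine (h1.add h2).congr_ae ?_
  have hne : ∀ᵐ s : ℝ, s ≠ a ∧ s ≠ -a :=
    (Measure.ae_ne volume a).and (Measure.ae_ne volume (-a))
  refine ae_restrict_of_ae (hne.mono fun s hs => ?_)
  have e1 : s - a ≠ 0 := sub_ne_zero.2 hs.1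
  have e2 : s + a ≠ 0 := fun h => hs.2 (by linarith)
  simp only [log_abs]
  rw [← log_mul e1 e2]
  congr 1
  ring

lemma measurable_abelKernel_mul {m : ℝ → ℝ} (hm : Continuous m) (a : ℝ) :
    Measurable fun p : ℝ × ℝ =>
      p.1 * m p.1 * (2 * p.2 / (√(p.2 ^ 2 - p.1 ^ 2) * √(p.2 ^ 2 - a ^ 2))) := by
  have := hm.measurable
  fun_prop

lemma integrableOn_mul_logKernel {m : ℝ → ℝ} (hm : Continuous m) {a T : ℝ} (haT : a < T)
    (ha : 0 ≤ a) :
    IntegrableOn (fun s => s * m s * (2 * log (√(T ^ 2 - s ^ 2) + √(T ^ 2 - a ^ 2)) -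
      log |s ^ 2 - a ^ 2|)) (Ioc 0 T) := by
  have hT : 0 ≤ T := ha.trans haT.le
  rw [← intervalIntegrable_iff_integrableOn_Ioc_of_le hT]
  refine IntervalIntegrable.continuousOn_mul ?_ (by fun_prop)
  refine IntervalIntegrable.sub (ContinuousOn.intervalIntegrable ?_)
    (intervalIntegrable_log_abs_sq_sub a 0 T)
  refine continuousOn_const.mul (ContinuousOn.log (by fun_prop) fun t _ => ?_)
  have := sqrt_pos.2 (sq_lt_sq_of_nonneg ha haT)
  positivity

/-- Composition of two Abel transforms. -/
lemma integral_abel_comp {m V : ℝ → ℝ} (hm : Continuous m) {a T : ℝ} (ha : 0 ≤ a) (haT : a < T)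
    (hV : ∀ t, 0 < t → V t = ∫ s in Ioc 0 t, s * m s / √(t ^ 2 - s ^ 2)) :
    IntegrableOn (fun t => 2 * t / √(t ^ 2 - a ^ 2) * V t) (Ioc 0 T) ∧
    ∫ t in Ioc 0 T, 2 * t / √(t ^ 2 - a ^ 2) * V t =
      ∫ s in Ioc 0 T, s * m s * (2 * log (√(T ^ 2 - s ^ 2) + √(T ^ 2 - a ^ 2)) -
        log |s ^ 2 - a ^ 2|) := by
  let K : ℝ → ℝ → ℝ := fun s t =>
    s * m s * (2 * t / (√(t ^ 2 - s ^ 2) * √(t ^ 2 - a ^ 2)))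
  have hae : ∀ᵐ s ∂(volume.restrict (Ioc 0 T)), s ∈ Ioc 0 T ∧ s ≠ a :=
    (ae_restrict_mem measurableSet_Ioc).and (ae_restrict_of_ae (Measure.ae_ne volume a))
  -- Tonelli: the Abel kernels are nonnegative, so the inner integral of the norm is |s m(s)| times
  -- the logarithmic kernel, which has only integrable singularities.
  have hKi : Integrable (Function.uncurry K)
      ((volume.restrict (Ioc 0 T)).prod (volume.restrict (Ioc 0 T))) := by
    have hmeas : Measurable (Function.uncurry K) := measurable_abelKernel_mul hm a
    rw [integrable_prod_iff hmeas.aestronglyMeasurable]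
    constructor
    · filter_upwards [hae] with s hs
      exact (integral_abelKernel hs.1.1.le ha hs.2 (max_le hs.1.2 haT.le)).1.const_mul (s * m s)
    · refine (integrableOn_mul_logKernel hm haT ha).norm.congr ?_
      filter_upwards [hae] with s hs
      have hk := integral_abelKernel hs.1.1.le ha hs.2 (max_le hs.1.2 haT.le)
      have hnn : 0 ≤ ∫ t in Ioc 0 T, 2 * t / (√(t ^ 2 - s ^ 2) * √(t ^ 2 - a ^ 2)) :=
        setIntegral_nonneg measurableSet_Ioc fun t ht => by
          have := ht.1
          positivity
      simp only [Function.uncurry, K, norm_mul]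
      rw [← hk.2, Real.norm_of_nonneg hnn, integral_const_mul]
      congr 1
      refine setIntegral_congr_fun measurableSet_Ioc fun t ht => ?_
      have := ht.1
      exact (Real.norm_of_nonneg (by positivity)).symm
  have hinner : ∀ t ∈ Ioc 0 T, ∫ s in Ioc 0 T, K s t = 2 * t / √(t ^ 2 - a ^ 2) * V t := by
    intro t ht
    rw [hV t ht.1, ← integral_const_mul]
    have hsub : Ioc 0 t ⊆ Ioc 0 T := Ioc_subset_Ioc_right ht.2
    rw [← setIntegral_eq_of_subset_of_forall_sdiff_eq_zero measurableSet_Ioc hsub]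
    · refine setIntegral_congr_fun measurableSet_Ioc fun s _ => ?_
      simp only [K]
      ring
    -- For s > t the kernel is 0 by the convention on roots and division, so integrating s up to T
    -- or up to t is the same.
    · intro s hs
      have : t < s := by
        by_contra h
        exact hs.2 ⟨hs.1.1, not_lt.1 h⟩
      rw [sqrt_eq_zero_of_nonpos (by nlinarith [ht.1] : t ^ 2 - s ^ 2 ≤ 0), div_zero, mul_zero]
  have hright := hKi.integral_prod_right
  refine ⟨hright.congr ?_, ?_⟩
  · filter_upwards [ae_restrict_mem measurableSet_Ioc] with t ht using hinner t ht
  · rw [← setIntegral_congr_fun measurableSet_Ioc hinner,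
      ← integral_integral_swap hKi]
    refine setIntegral_congr_ae measurableSet_Ioc ?_
    filter_upwards [Measure.ae_ne volume a] with s hs hsT
    simp only [K]
    rw [integral_const_mul, (integral_abelKernel hsT.1.le ha hs (max_le hsT.2 haT.le)).2]

end AbelKernel

/-! ### Pairing with square root kernels on the half line. -/

section HalfLine

lemma tendsto_sqrt_sq_sub_atTop (a : ℝ) : Tendsto (fun t : ℝ => √(t ^ 2 - a ^ 2)) atTop atTop := by
  refine tendsto_sqrt_atTop.comp ?_
  simpa [sub_eq_add_neg] using
    tendsto_atTop_add_const_right atTop (-a ^ 2) (tendsto_pow_atTop (α := ℝ) two_ne_zero)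

/-- An antiderivative is arctan(√(t² - a²)/a)/a. The integral is the common dominating bound for a
wave decaying like 1/t against the Abel kernel. -/
lemma integrable_inv_mul_sqrt {a : ℝ} (ha : 0 < a) :
    IntegrableOn (fun t => 1 / (t * √(t ^ 2 - a ^ 2))) (Ioi a) ∧
    ∫ t in Ioi a, 1 / (t * √(t ^ 2 - a ^ 2)) = π / (2 * a) := by
  let g : ℝ → ℝ := fun t => arctan (√(t ^ 2 - a ^ 2) / a) / a
  have hcont : ContinuousWithinAt g (Ici a) a := by
    have : Continuous g := by
      simp only [g]
      exact (continuous_arctan.comp (by fun_prop)).div_const a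
    exact this.continuousWithinAt
  have hder : ∀ t ∈ Ioi a, HasDerivAt g (1 / (t * √(t ^ 2 - a ^ 2))) t := by
    intro t ht
    have ht0 : 0 < t := ha.trans ht
    have hpos := sq_lt_sq_of_nonneg ha.le ht
    have hs := sqrt_pos.2 hpos
    refine ((((hasDerivAt_sqrt_sq_sub hpos).div_const a).arctan).div_const a).congr_deriv ?_
    rw [div_pow, sq_sqrt hpos.le]
    field_simp
    ring
  have hnn : ∀ t ∈ Ioi a, 0 ≤ 1 / (t * √(t ^ 2 - a ^ 2)) := fun t ht => by
    have : 0 < t := ha.trans ht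
    positivity
  have hlim : Tendsto g atTop (𝓝 (π / 2 / a)) :=
    (((tendsto_arctan_atTop.mono_right nhdsWithin_le_nhds).comp
      ((tendsto_sqrt_sq_sub_atTop a).atTop_div_const ha))).div_const a
  refine ⟨integrableOn_Ioi_deriv_of_nonneg hcont hder hnn hlim, ?_⟩
  rw [integral_Ioi_of_hasDerivAt_of_nonneg hcont hder hnn hlim]
  simp [g]
  field_simp

/-- Multiply by the larger root: (X - Y)X ≤ X² - Y² because Y ≤ X, and Y² ≥ t² - b² holds even where
the smaller root is truncated to 0. -/
lemma sqrt_sub_sqrt_bounds {a b t : ℝ} (ha : 0 ≤ a) (hab : a ≤ b) (hat : a < t) :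
    0 ≤ √(t ^ 2 - a ^ 2) - √(t ^ 2 - b ^ 2) ∧
    √(t ^ 2 - a ^ 2) - √(t ^ 2 - b ^ 2) ≤ (b ^ 2 - a ^ 2) / √(t ^ 2 - a ^ 2) := by
  have hle : √(t ^ 2 - b ^ 2) ≤ √(t ^ 2 - a ^ 2) := sqrt_le_sqrt (by nlinarith)
  have hpos := sq_lt_sq_of_nonneg ha hat
  have hs := sqrt_pos.2 hpos
  refine ⟨sub_nonneg.2 hle, ?_⟩
  rw [le_div_iff₀ hs]
  have h1 : √(t ^ 2 - a ^ 2) ^ 2 = t ^ 2 - a ^ 2 := sq_sqrt hpos.le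
  have h2 : t ^ 2 - b ^ 2 ≤ √(t ^ 2 - b ^ 2) ^ 2 := by
    rcases le_total 0 (t ^ 2 - b ^ 2) with h | h
    · rw [sq_sqrt h]
    · exact h.trans (sq_nonneg _)
  nlinarith [sqrt_nonneg (t ^ 2 - b ^ 2)]

variable {w V m : ℝ → ℝ}

lemma integrableOn_div_sqrt (hw : ContinuousOn w (Ioi 0)) {C : ℝ}
    (hwC : ∀ t, 0 < t → |w t| ≤ C / t) {a : ℝ} (ha : 0 < a) :
    IntegrableOn (fun t => w t / √(t ^ 2 - a ^ 2)) (Ioi a) := by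
  refine ((integrable_inv_mul_sqrt ha).1.const_mul C).mono' ?_ ?_
  · refine ContinuousOn.aestronglyMeasurable ?_ measurableSet_Ioi
    refine (hw.mono (Ioi_subset_Ioi ha.le)).div (by fun_prop) fun t ht => ?_
    exact (sqrt_pos.2 (sq_lt_sq_of_nonneg ha.le ht)).ne'
  · filter_upwards [ae_restrict_mem measurableSet_Ioi] with t ht
    have ht0 : 0 < t := ha.trans ht
    rw [norm_div, Real.norm_eq_abs, Real.norm_of_nonneg (sqrt_nonneg _)]
    calc |w t| / √(t ^ 2 - a ^ 2) ≤ C / t / √(t ^ 2 - a ^ 2) := by gcongr; exact hwC t ht0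
      _ = C * (1 / (t * √(t ^ 2 - a ^ 2))) := by field_simp

lemma integrableOn_mul_sqrt_sub_sqrt (hw : ContinuousOn w (Ioi 0)) {C : ℝ}
    (hwC : ∀ t, 0 < t → |w t| ≤ C / t) {a b : ℝ} (ha : 0 < a) (hab : a ≤ b) :
    IntegrableOn (fun t => (2 * √(t ^ 2 - a ^ 2) - 2 * √(t ^ 2 - b ^ 2)) * w t) (Ioi a) := by
  refine ((integrableOn_div_sqrt hw hwC ha).norm.const_mul (2 * (b ^ 2 - a ^ 2))).mono' ?_ ?_
  · exact ContinuousOn.aestronglyMeasurable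
      (ContinuousOn.mul (by fun_prop) (hw.mono (Ioi_subset_Ioi ha.le))) measurableSet_Ioi
  · filter_upwards [ae_restrict_mem measurableSet_Ioi] with t ht
    obtain ⟨h1, h2⟩ := sqrt_sub_sqrt_bounds ha.le hab ht
    rw [norm_mul, norm_div, Real.norm_of_nonneg (sqrt_nonneg _), ← mul_sub, Real.norm_of_nonneg
      (by positivity : 0 ≤ 2 * (√(t ^ 2 - a ^ 2) - √(t ^ 2 - b ^ 2)))]
    calc _ ≤ 2 * ((b ^ 2 - a ^ 2) / √(t ^ 2 - a ^ 2)) * ‖w t‖ := by gcongr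
      _ = _ := by ring

/-- Integration by parts against the kernel `2√(t² - a²)`. -/
lemma integral_sqrt_mul_deriv (hder : ∀ t, 0 < t → HasDerivAt V (w t) t)
    (hw : ContinuousOn w (Ioi 0)) {a T : ℝ} (ha : 0 < a) (haT : a ≤ T) :
    IntegrableOn (fun t => 2 * √(t ^ 2 - a ^ 2) * w t) (Ioc 0 T) ∧
    ∫ t in Ioc 0 T, 2 * √(t ^ 2 - a ^ 2) * w t =
      2 * √(T ^ 2 - a ^ 2) * V T - ∫ t in Ioc 0 T, 2 * t / √(t ^ 2 - a ^ 2) * V t := by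
  have hIcc : Icc a T ⊆ Ioi 0 := fun t ht => ha.trans_le ht.1
  have hVc : ContinuousOn V (Icc a T) := fun t ht =>
    (hder t (hIcc ht)).continuousAt.continuousWithinAt
  have hzero : ∀ t ∈ Ioc 0 a, √(t ^ 2 - a ^ 2) = 0 := fun t ht =>
    sqrt_eq_zero_of_nonpos (by nlinarith [ht.1, ht.2])
  have hwi : IntervalIntegrable w volume a T :=
    ContinuousOn.intervalIntegrable (by rw [uIcc_of_le haT]; exact hw.mono hIcc)
  have hder2 : ∀ t ∈ Ioo a T, HasDerivAt (fun t => 2 * √(t ^ 2 - a ^ 2))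
      (2 * t / √(t ^ 2 - a ^ 2)) t := fun t ht =>
    ((hasDerivAt_sqrt_sq_sub (sq_lt_sq_of_nonneg ha.le ht.1)).const_mul 2).congr_deriv (by ring)
  have hki : IntervalIntegrable (fun t => 2 * t / √(t ^ 2 - a ^ 2)) volume a T := by
    rw [intervalIntegrable_iff_integrableOn_Ioc_of_le haT]
    exact intervalIntegral.integrableOn_deriv_of_nonneg (by fun_prop) hder2 fun t ht => by
      have := ha.trans ht.1
      positivity
  have hparts := intervalIntegral.integral_mul_deriv_eq_deriv_mul_of_hasDerivAt
    (u := fun t => 2 * √(t ^ 2 - a ^ 2)) (v := V) (v' := w)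
    (by fun_prop) (by rwa [uIcc_of_le haT])
    (by rwa [min_eq_left haT, max_eq_right haT])
    (by rw [min_eq_left haT, max_eq_right haT]
        exact fun t ht => hder t (ha.trans ht.1)) hki hwi
  rw [sub_self, sqrt_zero, mul_zero, zero_mul, sub_zero, intervalIntegral.integral_of_le haT,
    intervalIntegral.integral_of_le haT] at hparts
  have hsub : Ioc a T ⊆ Ioc 0 T := Ioc_subset_Ioc_left ha.le
  have hdiff : ∀ t ∈ Ioc 0 T \ Ioc a T, √(t ^ 2 - a ^ 2) = 0 := fun t ht =>
    hzero t ⟨ht.1.1, not_lt.1 fun h => ht.2 ⟨h, ht.1.2⟩⟩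
  constructor
  · have h1 : IntegrableOn (fun t => 2 * √(t ^ 2 - a ^ 2) * w t) (Ioc a T) :=
      (intervalIntegrable_iff_integrableOn_Ioc_of_le haT).1
        (hwi.continuousOn_mul (by fun_prop))
    have h0 : IntegrableOn (fun t => 2 * √(t ^ 2 - a ^ 2) * w t) (Ioc 0 a) :=
      (integrableOn_zero (ε' := ℝ)).congr_fun (fun t ht => by simp [hzero t ht]) measurableSet_Ioc
    rw [← Ioc_union_Ioc_eq_Ioc ha.le haT]
    exact h0.union h1
  · rw [setIntegral_eq_of_subset_of_forall_sdiff_eq_zero measurableSet_Ioc hsub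
      (fun t ht => by rw [hdiff t ht]; simp),
      setIntegral_eq_of_subset_of_forall_sdiff_eq_zero measurableSet_Ioc hsub
      (fun t ht => by rw [hdiff t ht]; simp), hparts]

/-- Integration by parts followed by the composition of Abel transforms; since m vanishes beyond R,
the domain in s no longer depends on T. -/
lemma integral_sqrt_mul_eq_log (hm : Continuous m) {R : ℝ} (hmR : ∀ s, R < s → m s = 0)
    (hder : ∀ t, 0 < t → HasDerivAt V (w t) t) (hw : ContinuousOn w (Ioi 0))
    (hV : ∀ t, 0 < t → V t = ∫ s in Ioc 0 t, s * m s / √(t ^ 2 - s ^ 2))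
    {a T : ℝ} (ha : 0 < a) (haT : a < T) (hRT : R ≤ T) :
    ∫ t in Ioc 0 T, 2 * √(t ^ 2 - a ^ 2) * w t = 2 * √(T ^ 2 - a ^ 2) * V T -
      ∫ s in Ioc 0 R, s * m s * (2 * log (√(T ^ 2 - s ^ 2) + √(T ^ 2 - a ^ 2)) -
        log |s ^ 2 - a ^ 2|) := by
  rw [(integral_sqrt_mul_deriv hder hw ha haT.le).2, (integral_abel_comp hm ha.le haT hV).2]
  congr 1
  refine setIntegral_eq_of_subset_of_forall_sdiff_eq_zero measurableSet_Ioc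
    (Ioc_subset_Ioc_right hRT) fun s hs => ?_
  rw [hmR s (not_le.1 fun h => hs.2 ⟨hs.1.1, h⟩)]
  simp

/-- The bound is uniform in X. It serves with X = √(T² - s²), to make the horizon-dependent
logarithms cancel as T → ∞ uniformly in s. -/
lemma abs_log_add_sub_log_add_le {X A B : ℝ} (hX : 0 ≤ X) (hB : 0 < B) (hBA : B ≤ A) :
    |log (X + A) - log (X + B)| ≤ (A - B) / B := by
  have hXB : 0 < X + B := by positivity
  have hXA : 0 < X + A := by linarith
  rw [abs_of_nonneg (sub_nonneg.2 (log_le_log hXB (by linarith))), ← log_div hXA.ne' hXB.ne']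
  calc log ((X + A) / (X + B)) ≤ (X + A) / (X + B) - 1 := log_le_sub_one_of_pos (by positivity)
    _ = (A - B) / (X + B) := by field_simp; ring
    _ ≤ (A - B) / B := by gcongr; linarith

/-- The pairing of a wave with the difference of two kernels `2√(t² - a²)`. -/
lemma integral_sqrt_sub_sqrt_mul_eq_log (hm : Continuous m) {R : ℝ}
    (hmR : ∀ s, R < s → m s = 0)
    (hder : ∀ t, 0 < t → HasDerivAt V (w t) t) (hw : ContinuousOn w (Ioi 0))
    (hV : ∀ t, 0 < t → V t = ∫ s in Ioc 0 t, s * m s / √(t ^ 2 - s ^ 2))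
    {C C' : ℝ} (hwC : ∀ t, 0 < t → |w t| ≤ C / t) (hVC : ∀ t, 0 < t → |V t| ≤ C')
    {a b : ℝ} (ha : 0 < a) (hab : a ≤ b) :
    ∫ t in Ioi a, (2 * √(t ^ 2 - a ^ 2) - 2 * √(t ^ 2 - b ^ 2)) * w t =
      ∫ s in Ioc 0 R, s * m s * (log |s ^ 2 - a ^ 2| - log |s ^ 2 - b ^ 2|) := by
  have hb : 0 < b := ha.trans_le hab
  set η : ℝ → ℝ := fun T => (√(T ^ 2 - a ^ 2) - √(T ^ 2 - b ^ 2)) / √(T ^ 2 - b ^ 2) with hη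
  -- the difference of the two roots tends to zero
  have hd0 : Tendsto (fun T => √(T ^ 2 - a ^ 2) - √(T ^ 2 - b ^ 2)) atTop (𝓝 0) := by
    refine squeeze_zero' ?_ ?_ ((tendsto_const_nhds (x := b ^ 2 - a ^ 2)).div_atTop
      (tendsto_sqrt_sq_sub_atTop a))
    · filter_upwards [eventually_gt_atTop a] with T hT using (sqrt_sub_sqrt_bounds ha.le hab hT).1
    · filter_upwards [eventually_gt_atTop a] with T hT using (sqrt_sub_sqrt_bounds ha.le hab hT).2
  have hη0 : Tendsto η atTop (𝓝 0) := hd0.div_atTop (tendsto_sqrt_sq_sub_atTop b)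
  have hmi : IntegrableOn (fun s => |s * m s|) (Ioc 0 R) :=
    (show Continuous fun s => |s * m s| by fun_prop).continuousOn.integrableOn_Icc.mono_set
      Ioc_subset_Icc_self
  have hmli : ∀ c, IntegrableOn (fun s => s * m s * log |s ^ 2 - c ^ 2|) (Ioc 0 R) := fun c => by
    rcases le_total 0 R with hR | hR
    · exact (intervalIntegrable_iff_integrableOn_Ioc_of_le hR).1
        ((intervalIntegrable_log_abs_sq_sub c 0 R).continuousOn_mul (by fun_prop))
    · simp [Ioc_eq_empty (not_lt.2 hR)]
  have hmLi : ∀ c T, 0 ≤ c → c < T →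
      IntegrableOn (fun s => s * m s * (2 * log (√(T ^ 2 - s ^ 2) + √(T ^ 2 - c ^ 2))))
        (Ioc 0 R) := fun c T hc hcT => by
    refine (ContinuousOn.integrableOn_Icc ?_).mono_set Ioc_subset_Icc_self
    refine ContinuousOn.mul (by fun_prop)
      (continuousOn_const.mul (ContinuousOn.log (by fun_prop) fun s _ => ?_))
    have := sqrt_pos.2 (sq_lt_sq_of_nonneg hc hcT)
    positivity
  have hformula : ∀ᶠ T in atTop,
      ∫ t in a..T, (2 * √(t ^ 2 - a ^ 2) - 2 * √(t ^ 2 - b ^ 2)) * w t =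
      2 * (√(T ^ 2 - a ^ 2) - √(T ^ 2 - b ^ 2)) * V T -
      (∫ s in Ioc 0 R, s * m s * (2 * (log (√(T ^ 2 - s ^ 2) + √(T ^ 2 - a ^ 2)) -
        log (√(T ^ 2 - s ^ 2) + √(T ^ 2 - b ^ 2))))) +
      ∫ s in Ioc 0 R, s * m s * (log |s ^ 2 - a ^ 2| - log |s ^ 2 - b ^ 2|) := by
    filter_upwards [eventually_gt_atTop b, eventually_ge_atTop R] with T hbT hRT
    have haT : a < T := hab.trans_lt hbT
    have e1 : ∫ t in a..T, (2 * √(t ^ 2 - a ^ 2) - 2 * √(t ^ 2 - b ^ 2)) * w t =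
        (∫ t in Ioc 0 T, 2 * √(t ^ 2 - a ^ 2) * w t) -
          ∫ t in Ioc 0 T, 2 * √(t ^ 2 - b ^ 2) * w t := by
      rw [← integral_sub (integral_sqrt_mul_deriv hder hw ha haT.le).1
        (integral_sqrt_mul_deriv hder hw hb hbT.le).1, intervalIntegral.integral_of_le haT.le]
      simp only [← sub_mul]
      refine (setIntegral_eq_of_subset_of_forall_sdiff_eq_zero measurableSet_Ioc
        (Ioc_subset_Ioc_left ha.le) fun t ht => ?_).symm
      have hta : t ≤ a := not_lt.1 fun h => ht.2 ⟨h, ht.1.2⟩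
      rw [sqrt_eq_zero_of_nonpos (by nlinarith [ht.1.1] : t ^ 2 - a ^ 2 ≤ 0),
        sqrt_eq_zero_of_nonpos (by nlinarith [ht.1.1] : t ^ 2 - b ^ 2 ≤ 0)]
      simp
    have e2 : (∫ s in Ioc 0 R, s * m s * (2 * (log (√(T ^ 2 - s ^ 2) + √(T ^ 2 - a ^ 2)) -
        log (√(T ^ 2 - s ^ 2) + √(T ^ 2 - b ^ 2))))) -
        (∫ s in Ioc 0 R, s * m s * (log |s ^ 2 - a ^ 2| - log |s ^ 2 - b ^ 2|)) =
        (∫ s in Ioc 0 R, s * m s * (2 * log (√(T ^ 2 - s ^ 2) + √(T ^ 2 - a ^ 2)) -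
          log |s ^ 2 - a ^ 2|)) -
        ∫ s in Ioc 0 R, s * m s * (2 * log (√(T ^ 2 - s ^ 2) + √(T ^ 2 - b ^ 2)) -
          log |s ^ 2 - b ^ 2|) := by
      simp only [mul_sub]
      rw [integral_sub (hmLi a T ha.le haT) (hmLi b T hb.le hbT),
        integral_sub (hmli a) (hmli b), integral_sub (hmLi a T ha.le haT) (hmli a),
        integral_sub (hmLi b T hb.le hbT) (hmli b)]
      ring
    rw [e1, integral_sqrt_mul_eq_log hm hmR hder hw hV ha haT hRT,
      integral_sqrt_mul_eq_log hm hmR hder hw hV hb hbT hRT]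
    linear_combination e2
  have hfirst : Tendsto (fun T => 2 * (√(T ^ 2 - a ^ 2) - √(T ^ 2 - b ^ 2)) * V T) atTop
      (𝓝 0) := by
    have hb2 : Tendsto (fun T => 2 * |√(T ^ 2 - a ^ 2) - √(T ^ 2 - b ^ 2)| * C') atTop (𝓝 0) := by
      simpa using (hd0.abs.const_mul 2).mul_const C'
    refine squeeze_zero_norm' ?_ hb2
    filter_upwards [eventually_gt_atTop 0] with T hT
    rw [norm_mul, norm_mul, Real.norm_eq_abs, Real.norm_eq_abs, Real.norm_eq_abs, abs_two]
    gcongr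
    exact hVC T hT
  have hsecond : Tendsto (fun T => ∫ s in Ioc 0 R, s * m s *
      (2 * (log (√(T ^ 2 - s ^ 2) + √(T ^ 2 - a ^ 2)) -
        log (√(T ^ 2 - s ^ 2) + √(T ^ 2 - b ^ 2))))) atTop (𝓝 0) := by
    have hb2 : Tendsto (fun T => (∫ s in Ioc 0 R, |s * m s|) * (2 * η T)) atTop (𝓝 0) := by
      simpa using (hη0.const_mul 2).const_mul (∫ s in Ioc 0 R, |s * m s|)
    refine squeeze_zero_norm' ?_ hb2
    filter_upwards [eventually_gt_atTop b] with T hT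
    rw [← integral_mul_const]
    refine norm_integral_le_of_norm_le (hmi.mul_const _) (ae_of_all _ fun s => ?_)
    rw [norm_mul, Real.norm_eq_abs, Real.norm_eq_abs, abs_mul 2, abs_two]
    gcongr
    exact abs_log_add_sub_log_add_le (sqrt_nonneg _)
      (sqrt_pos.2 (sq_lt_sq_of_nonneg hb.le hT)) (sqrt_le_sqrt (by nlinarith))
  -- The improper integral is the limit of its truncations, and in the truncated formula only the
  -- T-independent logarithms survive.
  have hlim := intervalIntegral_tendsto_integral_Ioi a
    (integrableOn_mul_sqrt_sub_sqrt hw hwC ha hab) tendsto_id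
  have hlim2 := (hfirst.sub hsecond).add_const
    (∫ s in Ioc 0 R, s * m s * (log |s ^ 2 - a ^ 2| - log |s ^ 2 - b ^ 2|))
  rw [sub_self, zero_add] at hlim2
  exact tendsto_nhds_unique hlim (hlim2.congr' (hformula.mono fun T hT => hT.symm))

end HalfLine

/-! ### Polar coordinates and radial weights. -/

section Polar

/-- Polar coordinates about `y`. -/
lemma integral_eq_integral_polar (F : EuclideanSpace ℝ (Fin 2) → ℝ)
    (y : EuclideanSpace ℝ (Fin 2)) :
    ∫ w, F w = ∫ p in Ioi (0 : ℝ) ×ˢ Ioo (-π) π, p.1 * F (y + p.1 • unitVec p.2) := by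
  rw [← integral_add_left_eq_self F y,
    ← (PiLp.volume_preserving_toLp (Fin 2)).integral_comp
      (MeasurableEquiv.toLp 2 _).measurableEmbedding,
    ← (volume_preserving_finTwoArrow ℝ).symm.integral_comp
      (MeasurableEquiv.finTwoArrow).symm.measurableEmbedding,
    ← integral_comp_polarCoord_symm]
  refine setIntegral_congr_fun polarCoord.open_target.measurableSet fun p _ => ?_
  simp only [smul_eq_mul]
  congr 3
  ext i
  fin_cases i <;> simp [unitVec, polarCoord]

lemma integral_Ioo_angle_eq (f : EuclideanSpace ℝ (Fin 2) → ℝ)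
    (y : EuclideanSpace ℝ (Fin 2)) (s : ℝ) :
    ∫ φ in Ioo (-π) π, f (y + s • unitVec φ) = angularIntegral f y s := by
  rw [← integral_Ioc_eq_integral_Ioo, ← intervalIntegral.integral_of_le (by linarith [pi_pos])]
  have hp : Function.Periodic (fun φ => f (y + s • unitVec φ)) (2 * π) := fun φ => by
    simp only [unitVec_add_two_pi]
  have := hp.intervalIntegral_add_eq (-π) 0
  rw [show -π + 2 * π = π by ring, zero_add] at this
  exact this

variable {f : EuclideanSpace ℝ (Fin 2) → ℝ}

/-- The integral of a continuous compactly supported function against a radial function. -/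
lemma integral_mul_radial (hf : Continuous f) {M R : ℝ} (hM : ∀ w, |f w| ≤ M)
    (y : EuclideanSpace ℝ (Fin 2)) (hy : ∀ s φ, R < s → f (y + s • unitVec φ) = 0)
    {L : ℝ → ℝ} (hL : IntegrableOn (fun s => s * L s) (Ioc 0 R)) :
    ∫ w, f w * L ‖y - w‖ = ∫ s in Ioc 0 R, s * angularIntegral f y s * L s := by
  rw [integral_eq_integral_polar _ y]
  have e1 : ∫ p in Ioi (0 : ℝ) ×ˢ Ioo (-π) π,
      p.1 * (f (y + p.1 • unitVec p.2) * L ‖y - (y + p.1 • unitVec p.2)‖) =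
      ∫ p in Ioc (0 : ℝ) R ×ˢ Ioo (-π) π, f (y + p.1 • unitVec p.2) * (p.1 * L p.1) := by
    have hsub : Ioc (0 : ℝ) R ×ˢ Ioo (-π) π ⊆ Ioi (0 : ℝ) ×ˢ Ioo (-π) π :=
      prod_mono Ioc_subset_Ioi_self subset_rfl
    rw [← setIntegral_eq_of_subset_of_forall_sdiff_eq_zero
      (measurableSet_Ioi.prod measurableSet_Ioo) hsub]
    · refine setIntegral_congr_fun (measurableSet_Ioi.prod measurableSet_Ioo) fun p hp => ?_
      have h0 : 0 < p.1 := hp.1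
      simp only [sub_add_cancel_left, norm_neg, norm_smul, norm_unitVec, mul_one,
        Real.norm_of_nonneg h0.le]
      ring
    · intro p hp
      rw [hy p.1 p.2 (not_le.1 fun h => hp.2 ⟨⟨hp.1.1, h⟩, hp.1.2⟩), zero_mul]
  have hint : IntegrableOn (fun p : ℝ × ℝ => f (y + p.1 • unitVec p.2) * (p.1 * L p.1))
      (Ioc (0 : ℝ) R ×ˢ Ioo (-π) π) (volume.prod volume) := by
    rw [IntegrableOn, ← Measure.prod_restrict]
    have h1 : Integrable (fun p : ℝ × ℝ => (p.1 * L p.1) * (1 : ℝ))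
        ((volume.restrict (Ioc 0 R)).prod (volume.restrict (Ioo (-π) π))) :=
      hL.mul_prod (integrable_const 1)
    simp only [mul_one] at h1
    exact h1.bdd_mul (c := M) (by fun_prop) (ae_of_all _ fun p => hM _)
  rw [e1, Measure.volume_eq_prod, setIntegral_prod _ hint]
  refine setIntegral_congr_fun measurableSet_Ioc fun s _ => ?_
  simp only
  rw [integral_mul_const, integral_Ioo_angle_eq]
  ring

lemma integrable_mul_radial (hf : Continuous f) {M R : ℝ} (hM : ∀ w, |f w| ≤ M)
    (y : EuclideanSpace ℝ (Fin 2)) (hy : ∀ w, R ≤ ‖y - w‖ → f w = 0)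
    {L : ℝ → ℝ} (hL : IntegrableOn (fun s => s * L s) (Ioc 0 R)) :
    Integrable fun w => f w * L ‖y - w‖ := by
  have h1 : IntegrableOn (fun w : EuclideanSpace ℝ (Fin 2) => L ‖w‖) (Metric.ball 0 R) := by
    rw [integrableOn_fun_norm_addHaar]
    simpa using hL.mono_set Ioo_subset_Ioc_self
  have h2 := ((integrable_indicator_iff Metric.isOpen_ball.measurableSet).2 h1).comp_sub_left y
  refine (h2.bdd_mul (c := M) hf.aestronglyMeasurable (ae_of_all _ hM)).congr
    (ae_of_all _ fun w => ?_)
  simp only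
  by_cases hw : ‖y - w‖ < R
  · rw [indicator_of_mem (by simpa using hw)]
  · rw [hy w (not_lt.1 hw), zero_mul, zero_mul]

end Polar

/-! ### Arc length measure on the circle and its rotation invariance. -/

section Circle

lemma exists_eq_norm_smul_unitVec (v : EuclideanSpace ℝ (Fin 2)) :
    ∃ φ ∈ Icc (-π) π, v = ‖v‖ • unitVec φ := by
  set c : ℂ := ⟨v 0, v 1⟩ with hc
  have hn : ‖c‖ = ‖v‖ := by
    simp [Complex.norm_eq_sqrt_sq_add_sq, EuclideanSpace.norm_eq, Fin.sum_univ_two, hc]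
  refine ⟨Complex.arg c, ⟨(Complex.neg_pi_lt_arg c).le, Complex.arg_le_pi c⟩, ?_⟩
  ext i
  fin_cases i
  · simpa [unitVec, hn] using (Complex.norm_mul_cos_arg c).symm
  · simpa [unitVec, hn] using (Complex.norm_mul_sin_arg c).symm

/-- Rotation of the plane by the angle `φ`. -/
noncomputable def planeRotation (φ : ℝ) :
    EuclideanSpace ℝ (Fin 2) ≃ₗᵢ[ℝ] EuclideanSpace ℝ (Fin 2) :=
  (EuclideanSpace.basisFun (Fin 2) ℝ).equiv (rotatedBasis φ) (Equiv.refl _)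

lemma planeRotation_apply (φ : ℝ) (v : EuclideanSpace ℝ (Fin 2)) :
    planeRotation φ v = v 0 • unitVec φ + v 1 • unitVecDeriv φ := by
  rw [planeRotation, OrthonormalBasis.equiv_apply_euclideanSpace, Fin.sum_univ_two,
    coe_rotatedBasis]
  simp

lemma planeRotation_unitVec (φ ψ : ℝ) : planeRotation φ (unitVec ψ) = unitVec (φ + ψ) := by
  rw [planeRotation_apply]
  ext i
  fin_cases i <;> simp [unitVec, unitVecDeriv, cos_add, sin_add] <;> ring

lemma lipschitzWith_circleParam (z : EuclideanSpace ℝ (Fin 2)) (ρ : ℝ) :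
    LipschitzWith ‖ρ‖₊ fun φ => z + ρ • unitVec φ := by
  have hd : ∀ φ, HasDerivAt (fun φ => z + ρ • unitVec φ) (ρ • unitVecDeriv φ) φ := fun φ =>
    ((hasDerivAt_unitVec φ).const_smul ρ).const_add z
  refine lipschitzWith_of_nnnorm_deriv_le (fun φ => (hd φ).differentiableAt) fun φ => ?_
  rw [(hd φ).deriv, ← NNReal.coe_le_coe]
  simp [norm_smul]

/-- The circle lies in the Lipschitz image of a compact interval, so its one-dimensional Hausdorff
measure is finite. -/
instance isFiniteMeasure_circleSurfaceMeasure (z : EuclideanSpace ℝ (Fin 2)) (ρ : ℝ) :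
    IsFiniteMeasure (circleSurfaceMeasure z ρ) := by
  refine ⟨?_⟩
  rw [circleSurfaceMeasure, Measure.restrict_apply_univ]
  have hsub : Metric.sphere z ρ ⊆ (fun φ => z + ρ • unitVec φ) '' Icc (-π) π := by
    intro y hy
    obtain ⟨φ, hφ, h⟩ := exists_eq_norm_smul_unitVec (y - z)
    refine ⟨φ, hφ, ?_⟩
    rw [mem_sphere_iff_norm] at hy
    simp only
    rw [← hy, ← h]
    abel
  refine (measure_mono hsub).trans_lt (((lipschitzWith_circleParam z ρ).hausdorffMeasure_image_le
    zero_le_one _).trans_lt ?_)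
  rw [hausdorffMeasure_real, Real.volume_Icc]
  exact ENNReal.mul_lt_top (by simp) ENNReal.ofReal_lt_top

lemma measurePreserving_rotation_circleSurfaceMeasure (z : EuclideanSpace ℝ (Fin 2)) (ρ φ : ℝ) :
    MeasurePreserving (fun y => z + planeRotation φ (y - z)) (circleSurfaceMeasure z ρ)
      (circleSurfaceMeasure z ρ) := by
  let T : EuclideanSpace ℝ (Fin 2) ≃ᵢ EuclideanSpace ℝ (Fin 2) :=
    ((IsometryEquiv.subRight z).trans (planeRotation φ).toIsometryEquiv).trans
      (IsometryEquiv.addLeft z)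
  have hpre : T ⁻¹' Metric.sphere z ρ = Metric.sphere z ρ := by
    ext y
    simp [T, mem_sphere_iff_norm]
  have h := (T.measurePreserving_hausdorffMeasure 1).restrict_preimage
    (Metric.isClosed_sphere (x := z) (ε := ρ)).measurableSet
  rw [hpre] at h
  exact h

/-- The integral of a continuous function over a circle is a multiple of its angular average. -/
lemma two_pi_mul_integral_circleSurfaceMeasure (z : EuclideanSpace ℝ (Fin 2)) (ρ : ℝ)
    (g : BoundedContinuousFunction (EuclideanSpace ℝ (Fin 2)) ℝ) :
    2 * π * ∫ y, g y ∂(circleSurfaceMeasure z ρ) =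
      (circleSurfaceMeasure z ρ).real univ * ∫ φ in (0 : ℝ)..(2 * π), g (z + ρ • unitVec φ) := by
  have h2π : (0 : ℝ) ≤ 2 * π := by positivity
  have hinv : ∀ φ, ∫ y, g (z + planeRotation φ (y - z)) ∂(circleSurfaceMeasure z ρ) =
      ∫ y, g y ∂(circleSurfaceMeasure z ρ) := fun φ => by
    have h := measurePreserving_rotation_circleSurfaceMeasure z ρ φ
    conv_rhs => rw [← h.map_eq]
    rw [integral_map h.measurable.aemeasurable g.continuous.aestronglyMeasurable]
  have hcont : Continuous fun p : ℝ × EuclideanSpace ℝ (Fin 2) =>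
      g (z + planeRotation p.1 (p.2 - z)) := by
    simp only [planeRotation_apply]
    fun_prop
  have hper : ∀ y ∈ Metric.sphere z ρ, ∫ φ in (0 : ℝ)..(2 * π),
      g (z + planeRotation φ (y - z)) = ∫ φ in (0 : ℝ)..(2 * π), g (z + ρ • unitVec φ) := by
    intro y hy
    obtain ⟨ψ, -, h⟩ := exists_eq_norm_smul_unitVec (y - z)
    rw [mem_sphere_iff_norm] at hy
    rw [hy] at h
    simp only [h, map_smul, planeRotation_unitVec]
    rw [intervalIntegral.integral_comp_add_right (fun φ => g (z + ρ • unitVec φ)) ψ]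
    have hp : Function.Periodic (fun φ => g (z + ρ • unitVec φ)) (2 * π) := fun φ => by
      simp only [unitVec_add_two_pi]
    have := hp.intervalIntegral_add_eq ψ 0
    rw [zero_add] at this ⊢
    rw [add_comm (2 * π) ψ, this]
  -- Average the rotation-invariant integral over all rotations and swap: the inner integral over
  -- angles is the same for every point of the circle.
  calc 2 * π * ∫ y, g y ∂(circleSurfaceMeasure z ρ)
      = ∫ φ in (0 : ℝ)..(2 * π), ∫ y, g (z + planeRotation φ (y - z))
          ∂(circleSurfaceMeasure z ρ) := by
        simp only [hinv, intervalIntegral.integral_const, sub_zero, smul_eq_mul]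
    _ = ∫ y, (∫ φ in (0 : ℝ)..(2 * π), g (z + planeRotation φ (y - z)))
          ∂(circleSurfaceMeasure z ρ) := by
        simp only [intervalIntegral.integral_of_le h2π]
        refine integral_integral_swap (Integrable.of_bound hcont.aestronglyMeasurable ‖g‖
          (ae_of_all _ fun p => g.norm_coe_le_norm _))
    _ = ∫ y, (∫ φ in (0 : ℝ)..(2 * π), g (z + ρ • unitVec φ)) ∂(circleSurfaceMeasure z ρ) := by
        refine integral_congr_ae ?_
        rw [circleSurfaceMeasure]
        filter_upwards [ae_restrict_mem Metric.isClosed_sphere.measurableSet] with y hy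
          using hper y hy
    _ = _ := by rw [integral_const, smul_eq_mul]

/-- The arc length measure is a multiple of the angular measure. -/
lemma exists_circleSurfaceMeasure_eq (z : EuclideanSpace ℝ (Fin 2)) (ρ : ℝ) :
    ∃ c : NNReal, circleSurfaceMeasure z ρ =
      c • (volume.restrict (Ioc 0 (2 * π))).map fun φ => z + ρ • unitVec φ := by
  have hc : Continuous fun φ => z + ρ • unitVec φ := by fun_prop
  -- The constant is the total mass over 2π. Its numerical value is never needed, because the final
  -- assertion is that an integral vanishes.
  refine ⟨((circleSurfaceMeasure z ρ).real univ / (2 * π)).toNNReal, ?_⟩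
  refine ext_of_forall_integral_eq_of_IsFiniteMeasure fun g => ?_
  rw [integral_smul_nnreal_measure, integral_map hc.aemeasurable
    g.continuous.aestronglyMeasurable, ← intervalIntegral.integral_of_le (by positivity),
    NNReal.smul_def, Real.coe_toNNReal _ (by positivity), smul_eq_mul, div_mul_eq_mul_div,
    ← two_pi_mul_integral_circleSurfaceMeasure]
  field_simp

end Circle

/-! ### Jensen's formula for log|α - β cos φ|. -/

section LogIntegral

/-- With ζ = exp(iφ) on the unit circle, -(β/2)(ζ - η)(ζ - η⁻¹) = ζ(α - β cos φ). Thus the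
logarithmic integral becomes a Mahler measure. -/
lemma abs_sub_mul_cos_eq_norm_eval {α β : ℝ} (hβ : 0 < β) {η : ℂ} (hη : η ≠ 0)
    (hηα : η + η⁻¹ = 2 * α / β) (φ : ℝ) :
    ‖Polynomial.eval (circleMap 0 1 φ) (Polynomial.C (-(β / 2) : ℂ) *
      ((Polynomial.X - Polynomial.C η) * (Polynomial.X - Polynomial.C η⁻¹)))‖ =
      |α - β * cos φ| := by
  have hβ' : (β : ℂ) ≠ 0 := by exact_mod_cast hβ.ne'
  have h1 : circleMap 0 1 φ * Complex.exp (-(φ * Complex.I)) = 1 := by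
    simp [circleMap, ← Complex.exp_add]
  have h2 : 2 * Complex.cos φ = circleMap 0 1 φ + Complex.exp (-(φ * Complex.I)) := by
    simp [circleMap, Complex.cos]
    ring_nf
  have h3 : Polynomial.eval (circleMap 0 1 φ) (Polynomial.C (-(β / 2) : ℂ) *
      ((Polynomial.X - Polynomial.C η) * (Polynomial.X - Polynomial.C η⁻¹))) =
      circleMap 0 1 φ * (α - β * cos φ : ℝ) := by
    simp only [Polynomial.eval_mul, Polynomial.eval_C, Polynomial.eval_sub, Polynomial.eval_X]
    push_cast
    have h4 : (circleMap 0 1 φ - η) * (circleMap 0 1 φ - η⁻¹) =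
        circleMap 0 1 φ ^ 2 - 2 * α / β * circleMap 0 1 φ + 1 := by
      rw [← hηα]
      field_simp
      ring
    rw [h4]
    have h5 : (β : ℂ) * (2 * α / β) = 2 * α := by field_simp
    linear_combination (circleMap 0 1 φ / 2) * h5 + (β / 2 * circleMap 0 1 φ) * h2 +
      (β / 2) * h1
  rw [h3, norm_mul, norm_circleMap_zero, Complex.norm_real]
  simp

/-- Jensen's formula for the trigonometric polynomial `α - β cos φ`. -/
lemma integral_log_abs_sub_mul_cos {α β : ℝ} (hβ : 0 < β) {η : ℂ} (hη : η ≠ 0)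
    (hηα : η + η⁻¹ = 2 * α / β) :
    ∫ φ in (0 : ℝ)..(2 * π), log |α - β * cos φ| =
      2 * π * (log (β / 2) + (posLog ‖η‖ + posLog ‖η⁻¹‖)) := by
  have hβ' : (-(β / 2) : ℂ) ≠ 0 := by
    have : (β : ℂ) ≠ 0 := by exact_mod_cast hβ.ne'
    simpa using this
  have h1 := Polynomial.logMahlerMeasure_C_mul hβ'
    (mul_ne_zero (Polynomial.X_sub_C_ne_zero η) (Polynomial.X_sub_C_ne_zero η⁻¹))
  rw [Polynomial.logMahlerMeasure_mul_eq_add_logMahlerMeasure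
    (mul_ne_zero (Polynomial.X_sub_C_ne_zero η) (Polynomial.X_sub_C_ne_zero η⁻¹)),
    Polynomial.logMahlerMeasure_X_sub_C, Polynomial.logMahlerMeasure_X_sub_C,
    Polynomial.logMahlerMeasure_def, circleAverage_def] at h1
  simp only [abs_sub_mul_cos_eq_norm_eval hβ hη hηα] at h1
  have h2 : ‖(-(β / 2) : ℂ)‖ = β / 2 := by
    rw [norm_neg, norm_div, Complex.norm_real, Real.norm_of_nonneg hβ.le]
    simp
  rw [h2, smul_eq_mul, inv_mul_eq_iff_eq_mul₀ (by positivity)] at h1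
  exact h1

/-- Here both roots η, η⁻¹ lie on the unit circle and contribute nothing to Jensen's formula, so the
value does not depend on α. The whole theorem rests on this independence. -/
lemma integral_log_abs_sub_mul_cos_of_le {α β : ℝ} (hβ : 0 < β) (h : |α| ≤ β) :
    ∫ φ in (0 : ℝ)..(2 * π), log |α - β * cos φ| = 2 * π * log (β / 2) := by
  set c := α / β with hc
  have hc1 : c ^ 2 ≤ 1 := by
    rw [hc, div_pow, div_le_one (by positivity), ← sq_abs]
    gcongr
  set η : ℂ := ⟨c, √(1 - c ^ 2)⟩ with hηdef
  have hns : Complex.normSq η = 1 := by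
    rw [Complex.normSq_mk]
    nlinarith [mul_self_sqrt (sub_nonneg.2 hc1)]
  have hn : ‖η‖ = 1 := by rw [Complex.norm_def, hns, sqrt_one]
  have hη : η ≠ 0 := fun h0 => by simp [h0] at hn
  rw [integral_log_abs_sub_mul_cos hβ hη, norm_inv, hn]
  · simp
  · rw [Complex.inv_def, hns]
    have e : (2 * α / β : ℂ) = ((2 * c : ℝ) : ℂ) := by rw [hc]; push_cast; ring
    rw [e]
    apply Complex.ext <;> simp [hηdef]
    ring

/-- For |α| > β the roots are the real numbers c ± √(c² - 1) with c = α/β. Each has modulus at most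
2|c| and so contributes at most log(2|c|) ≤ 2|c|. -/
lemma abs_integral_log_abs_sub_mul_cos_sub_le {α β : ℝ} (hβ : 0 < β) :
    |(∫ φ in (0 : ℝ)..(2 * π), log |α - β * cos φ|) - 2 * π * log (β / 2)| ≤
      8 * π * (|α| / β) := by
  rcases le_or_gt |α| β with h | h
  · rw [integral_log_abs_sub_mul_cos_of_le hβ h, sub_self, abs_zero]
    positivity
  set c := α / β with hc
  have hcabs : |c| = |α| / β := by rw [hc, abs_div, abs_of_pos hβ]
  have hc1 : 1 < |c| := by rwa [hcabs, one_lt_div hβ]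
  have hc2 : 0 < c ^ 2 - 1 := by nlinarith [sq_abs c]
  have hs := sq_sqrt hc2.le
  set s := √(c ^ 2 - 1) with hsdef
  have hs0 : 0 ≤ s := sqrt_nonneg _
  have hsc : s ≤ |c| := by
    rw [hsdef, ← sqrt_sq_eq_abs]
    exact sqrt_le_sqrt (by linarith)
  have hprod : (c + s) * (c - s) = 1 := by nlinarith
  have hη : ((c + s : ℝ) : ℂ) ≠ 0 := by
    have : c + s ≠ 0 := left_ne_zero_of_mul_eq_one hprod
    exact_mod_cast this
  have hinv : ((c + s : ℝ) : ℂ)⁻¹ = ((c - s : ℝ) : ℂ) := by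
    rw [inv_eq_iff_eq_inv, eq_comm, inv_eq_iff_eq_inv, eq_comm]
    rw [← Complex.ofReal_inv]
    congr 1
    exact (eq_inv_of_mul_eq_one_right hprod).symm
  have hpl : ∀ x : ℝ, |x| ≤ 2 * |c| → posLog ‖(x : ℂ)‖ ≤ 2 * |c| := fun x hx => by
    rw [Complex.norm_real, Real.norm_eq_abs]
    refine (posLog_le_posLog (abs_nonneg x) hx).trans ?_
    rw [posLog_eq_log (by rw [abs_of_pos (by positivity)]; linarith)]
    exact log_le_self (by positivity)
  rw [integral_log_abs_sub_mul_cos hβ hη (by rw [hinv, hc]; push_cast; ring), hinv, ← hcabs]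
  have h1 := hpl (c + s) ((abs_add_le _ _).trans (by rw [abs_of_nonneg hs0]; linarith))
  have h2 := hpl (c - s) ((abs_sub _ _).trans (by rw [abs_of_nonneg hs0]; linarith))
  have h3 : 0 ≤ posLog ‖((c + s : ℝ) : ℂ)‖ := posLog_nonneg
  have h4 : 0 ≤ posLog ‖((c - s : ℝ) : ℂ)‖ := posLog_nonneg
  rw [← mul_sub, add_sub_cancel_left, abs_of_nonneg (by positivity)]
  nlinarith [pi_pos]

end LogIntegral

/-! ### The logarithmic kernel: integrability and its circle integrals. -/

section LogKernel

lemma abs_log_abs_sq_sub_le (s b : ℝ) :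
    |log (|s ^ 2 - b ^ 2|)| ≤ |log (s - b)| + |log (s + b)| := by
  rw [log_abs, show s ^ 2 - b ^ 2 = (s - b) * (s + b) by ring]
  rcases eq_or_ne (s - b) 0 with h | h
  · rw [h]; simp
  rcases eq_or_ne (s + b) 0 with h' | h'
  · rw [h']; simp
  rw [log_mul h h']
  exact abs_add_le _ _

lemma setIntegral_abs_log_comp_le {b K R : ℝ} (hR : 0 ≤ R) (ha : -K ≤ b) (hb : R + b ≤ K) :
    IntegrableOn (fun s => |log (s + b)|) (Ioc 0 R) ∧
    ∫ s in Ioc 0 R, |log (s + b)| ≤ ∫ s in (-K)..K, |log s| := by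
  have hi : ∀ c d, IntervalIntegrable (fun s => |log s|) volume c d := fun c d =>
    intervalIntegral.intervalIntegrable_log'.abs
  refine ⟨(intervalIntegrable_iff_integrableOn_Ioc_of_le hR).1 ?_, ?_⟩
  · simpa using (hi b (R + b)).comp_add_right b
  · rw [← intervalIntegral.integral_of_le hR,
      intervalIntegral.integral_comp_add_right (fun s => |log s|) b, zero_add]
    exact intervalIntegral.integral_mono_interval ha (by linarith) hb
      (ae_of_all _ fun s => abs_nonneg _) (hi _ _)

lemma integrableOn_log_abs_sq_sub (R b : ℝ) :
    IntegrableOn (fun s => log |s ^ 2 - b ^ 2|) (Ioc 0 R) := by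
  rcases le_total 0 R with hR | hR
  · exact (intervalIntegrable_iff_integrableOn_Ioc_of_le hR).1
      (intervalIntegrable_log_abs_sq_sub b 0 R)
  · simp [Ioc_eq_empty (not_lt.2 hR)]

lemma integrableOn_mul_log_abs_sq_sub (R b : ℝ) :
    IntegrableOn (fun s => s * log |s ^ 2 - b ^ 2|) (Ioc 0 R) := by
  rcases le_total 0 R with hR | hR
  · exact (intervalIntegrable_iff_integrableOn_Ioc_of_le hR).1
      ((intervalIntegrable_log_abs_sq_sub b 0 R).continuousOn_mul (by fun_prop))
  · simp [Ioc_eq_empty (not_lt.2 hR)]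

lemma setIntegral_abs_log_abs_sq_sub_le {b B R : ℝ} (hR : 0 ≤ R) (hb : 0 ≤ b) (hB : b ≤ B) :
    ∫ s in Ioc 0 R, |log (|s ^ 2 - b ^ 2|)| ≤ 2 * ∫ s in (-(R + B))..(R + B), |log s| := by
  obtain ⟨h1, h1'⟩ := setIntegral_abs_log_comp_le (b := -b) (K := R + B) hR
    (by linarith) (by linarith)
  obtain ⟨h2, h2'⟩ := setIntegral_abs_log_comp_le (b := b) (K := R + B) hR
    (by linarith) (by linarith)
  calc ∫ s in Ioc 0 R, |log (|s ^ 2 - b ^ 2|)|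
      ≤ ∫ s in Ioc 0 R, (|log (s + -b)| + |log (s + b)|) :=
        setIntegral_mono (integrableOn_log_abs_sq_sub R b).abs (h1.add h2)
          fun s => abs_log_abs_sq_sub_le s b
    _ ≤ _ := by rw [integral_add h1 h2]; linarith

variable {f : EuclideanSpace ℝ (Fin 2) → ℝ} {z x : EuclideanSpace ℝ (Fin 2)} {ρ : ℝ}

/-- The logarithm of the power difference of `y` with respect to `w` and `x`. -/
noncomputable def logKernel (x : EuclideanSpace ℝ (Fin 2)) (ε : ℝ)
    (y w : EuclideanSpace ℝ (Fin 2)) : ℝ :=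
  log |‖y - w‖ ^ 2 - (‖x - y‖ ^ 2 + ε)|

lemma measurable_logKernel (x : EuclideanSpace ℝ (Fin 2)) (ε : ℝ) :
    Measurable fun p : EuclideanSpace ℝ (Fin 2) × EuclideanSpace ℝ (Fin 2) =>
      logKernel x ε p.1 p.2 := by
  unfold logKernel
  simp only [log_abs]
  exact measurable_log.comp (by fun_prop)

lemma measurable_logKernel_left (x : EuclideanSpace ℝ (Fin 2)) (ε : ℝ)
    (w : EuclideanSpace ℝ (Fin 2)) : Measurable fun y => logKernel x ε y w := by
  unfold logKernel
  simp only [log_abs]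
  exact measurable_log.comp (by fun_prop)

lemma logKernel_eq {ε : ℝ} (hε : 0 ≤ ε) (y w : EuclideanSpace ℝ (Fin 2)) :
    logKernel x ε y w = log |‖y - w‖ ^ 2 - √(‖x - y‖ ^ 2 + ε) ^ 2| := by
  rw [logKernel, sq_sqrt (by positivity)]

lemma add_smul_unitVec_notMem_tsupport (hfs : tsupport f ⊆ Metric.ball z ρ)
    {y : EuclideanSpace ℝ (Fin 2)} (hy : y ∈ Metric.sphere z ρ) {s : ℝ} (φ : ℝ) (hs : 2 * ρ < s) :
    y + s • unitVec φ ∉ tsupport f := by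
  intro h
  have h1 := hfs h
  rw [mem_ball_iff_norm] at h1
  rw [mem_sphere_iff_norm] at hy
  have hρ : 0 ≤ ρ := hy ▸ norm_nonneg _
  have h2 : ‖s • unitVec φ‖ ≤ ‖y + s • unitVec φ - z‖ + ‖y - z‖ := by
    have : s • unitVec φ = (y + s • unitVec φ - z) - (y - z) := by abel
    rw [this]
    simpa using norm_sub_le (y + s • unitVec φ - z) (y - z)
  rw [norm_smul, norm_unitVec, mul_one, Real.norm_of_nonneg (by linarith)] at h2
  linarith

lemma eq_zero_of_le_norm_sub (hfs : tsupport f ⊆ Metric.ball z ρ)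
    {y : EuclideanSpace ℝ (Fin 2)} (hy : y ∈ Metric.sphere z ρ) {w : EuclideanSpace ℝ (Fin 2)}
    (hw : 2 * ρ ≤ ‖y - w‖) : f w = 0 := by
  refine image_eq_zero_of_notMem_tsupport fun h => ?_
  have h1 := hfs h
  rw [mem_ball_iff_norm'] at h1
  rw [mem_sphere_iff_norm] at hy
  have := norm_add_le (y - z) (z - w)
  rw [sub_add_sub_cancel] at this
  linarith

lemma integral_mul_logKernel (hf : Continuous f) {M : ℝ} (hM : ∀ w, |f w| ≤ M)
    (hfs : tsupport f ⊆ Metric.ball z ρ) {y : EuclideanSpace ℝ (Fin 2)}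
    (hy : y ∈ Metric.sphere z ρ) {ε : ℝ} (hε : 0 ≤ ε) :
    Integrable (fun w => f w * logKernel x ε y w) ∧
    ∫ w, f w * logKernel x ε y w = ∫ s in Ioc 0 (2 * ρ), s * angularIntegral f y s *
      log |s ^ 2 - √(‖x - y‖ ^ 2 + ε) ^ 2| := by
  simp only [logKernel_eq hε]
  exact ⟨integrable_mul_radial hf hM y (fun w hw => eq_zero_of_le_norm_sub hfs hy hw)
    (integrableOn_mul_log_abs_sq_sub _ _), integral_mul_radial hf hM y (fun s φ hs =>
    image_eq_zero_of_notMem_tsupport (add_smul_unitVec_notMem_tsupport hfs hy φ hs))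
    (integrableOn_mul_log_abs_sq_sub _ _)⟩

lemma norm_sub_le_of_mem (hx : x ∈ Metric.ball z ρ) {y : EuclideanSpace ℝ (Fin 2)}
    (hy : y ∈ Metric.sphere z ρ) : ‖x - y‖ ≤ 2 * ρ ∧ ρ - ‖x - z‖ ≤ ‖x - y‖ := by
  rw [mem_ball_iff_norm] at hx
  rw [mem_sphere_iff_norm, norm_sub_rev] at hy
  constructor
  · have := norm_add_le (x - z) (z - y)
    rw [sub_add_sub_cancel] at this
    linarith
  · have := norm_sub_le (x - y) (x - z)
    rw [sub_sub_sub_cancel_left] at this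
    linarith

/-- The right side does not depend on y, which is what Fubini on circle times plane requires. The
factors bound the radius s, the angular integral of |f|, and the integral of the logarithm over one
large interval. -/
lemma integral_abs_mul_logKernel_le (hρ : 0 < ρ) (hf : Continuous f) {M : ℝ}
    (hM : ∀ w, |f w| ≤ M) (hfs : tsupport f ⊆ Metric.ball z ρ) (hx : x ∈ Metric.ball z ρ)
    {y : EuclideanSpace ℝ (Fin 2)} (hy : y ∈ Metric.sphere z ρ) {ε : ℝ} (hε : 0 ≤ ε) :
    ∫ w, ‖f w * logKernel x ε y w‖ ≤ 2 * ρ * (M * (2 * π)) * (2 * ∫ s in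
      (-(2 * ρ + √((2 * ρ) ^ 2 + ε)))..(2 * ρ + √((2 * ρ) ^ 2 + ε)), |log s|) := by
  set b := √(‖x - y‖ ^ 2 + ε) with hb
  set B := √((2 * ρ) ^ 2 + ε) with hB
  have hbB : b ≤ B := sqrt_le_sqrt (by gcongr; exact (norm_sub_le_of_mem hx hy).1)
  have hang : ∀ s, |angularIntegral (fun w => |f w|) y s| ≤ M * (2 * π) := fun s => by
    have := intervalIntegral.norm_integral_le_of_norm_le_const (a := 0) (b := 2 * π) (C := M)
      (f := fun φ => |f (y + s • unitVec φ)|) fun φ _ => by simpa using hM _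
    simpa [abs_of_pos pi_pos, angularIntegral] using this
  have hM0 : 0 ≤ M := (abs_nonneg _).trans (hM 0)
  have e1 : ∫ w, ‖f w * logKernel x ε y w‖ = ∫ s in Ioc 0 (2 * ρ),
      s * angularIntegral (fun w => |f w|) y s * |log (|s ^ 2 - b ^ 2|)| := by
    rw [← integral_mul_radial hf.abs (M := M) (by simpa using hM) y (fun s φ hs => by
      rw [image_eq_zero_of_notMem_tsupport (add_smul_unitVec_notMem_tsupport hfs hy φ hs),
        abs_zero]) (L := fun s => |log (|s ^ 2 - b ^ 2|)|)]
    · simp only [logKernel_eq hε, norm_mul, Real.norm_eq_abs]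
      rfl
    · refine (integrableOn_mul_log_abs_sq_sub (2 * ρ) b).abs.congr ?_
      filter_upwards [ae_restrict_mem measurableSet_Ioc] with s hs
      rw [abs_mul, abs_of_pos hs.1]
  rw [e1]
  calc _ ≤ ∫ s in Ioc 0 (2 * ρ), 2 * ρ * (M * (2 * π)) * |log (|s ^ 2 - b ^ 2|)| := by
        refine integral_mono_of_nonneg ?_ ((integrableOn_log_abs_sq_sub _ _).abs.const_mul _) ?_
        · filter_upwards [ae_restrict_mem measurableSet_Ioc] with s hs
          have h0 : 0 ≤ angularIntegral (fun w => |f w|) y s :=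
            intervalIntegral.integral_nonneg (by positivity) fun φ _ => abs_nonneg _
          have := hs.1
          simp only [Pi.zero_apply]
          positivity
        · filter_upwards [ae_restrict_mem measurableSet_Ioc] with s hs
          have h0 : 0 ≤ angularIntegral (fun w => |f w|) y s :=
            intervalIntegral.integral_nonneg (by positivity) fun φ _ => abs_nonneg _
          gcongr
          · exact hs.2
          · exact (le_abs_self _).trans (hang s)
    _ ≤ _ := by
        rw [integral_const_mul]
        gcongr
        exact setIntegral_abs_log_abs_sq_sub_le (by positivity) (sqrt_nonneg _) hbB

lemma ae_mem_sphere_circleSurfaceMeasure (z : EuclideanSpace ℝ (Fin 2)) (ρ : ℝ) :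
    ∀ᵐ y ∂(circleSurfaceMeasure z ρ), y ∈ Metric.sphere z ρ := by
  rw [circleSurfaceMeasure]
  exact ae_restrict_mem Metric.isClosed_sphere.measurableSet

lemma integrable_prod_mul_logKernel (hρ : 0 < ρ) (hf : Continuous f) {M : ℝ}
    (hM : ∀ w, |f w| ≤ M) (hfs : tsupport f ⊆ Metric.ball z ρ) (hx : x ∈ Metric.ball z ρ)
    {ε : ℝ} (hε : 0 ≤ ε) :
    Integrable (Function.uncurry fun y w => f w * logKernel x ε y w)
      ((circleSurfaceMeasure z ρ).prod volume) := by
  have hm : Measurable (Function.uncurry fun y w => f w * logKernel x ε y w) :=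
    (hf.measurable.comp measurable_snd).mul (measurable_logKernel x ε)
  rw [integrable_prod_iff hm.aestronglyMeasurable]
  constructor
  · filter_upwards [ae_mem_sphere_circleSurfaceMeasure z ρ] with y hy
      using (integral_mul_logKernel hf hM hfs hy hε).1
  · refine Integrable.of_bound hm.stronglyMeasurable.norm.integral_prod_right'.aestronglyMeasurable
      (2 * ρ * (M * (2 * π)) * (2 * ∫ s in
      (-(2 * ρ + √((2 * ρ) ^ 2 + ε)))..(2 * ρ + √((2 * ρ) ^ 2 + ε)), |log s|)) ?_
    filter_upwards [ae_mem_sphere_circleSurfaceMeasure z ρ] with y hy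
    rw [Real.norm_of_nonneg (integral_nonneg fun w => norm_nonneg _)]
    exact integral_abs_mul_logKernel_le hρ hf hM hfs hx hy hε

lemma inner_unitVec (φ ψ : ℝ) : inner ℝ (unitVec φ) (unitVec ψ) = cos (φ - ψ) := by
  simp [unitVec, PiLp.inner_apply, Fin.sum_univ_two, cos_sub]
  ring

lemma norm_add_smul_unitVec_sub_sq (z v : EuclideanSpace ℝ (Fin 2)) (ρ φ : ℝ) :
    ‖z + ρ • unitVec φ - v‖ ^ 2 =
      ρ ^ 2 - 2 * (ρ * inner ℝ (unitVec φ) (v - z)) + ‖v - z‖ ^ 2 := by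
  rw [show z + ρ • unitVec φ - v = ρ • unitVec φ - (v - z) by abel, norm_sub_sq_real,
    norm_smul, norm_unitVec, real_inner_smul_left, mul_one, Real.norm_eq_abs, sq_abs]

/-- The difference of the squared distances from y to w and to x is affine in y, hence a shifted
cosine on the circle. -/
lemma logKernel_circle {w : EuclideanSpace ℝ (Fin 2)} (ε : ℝ) {ψ : ℝ}
    (hψ : w - x = ‖w - x‖ • unitVec ψ) (φ : ℝ) :
    logKernel x ε (z + ρ • unitVec φ) w =
      log |(‖w - z‖ ^ 2 - ‖x - z‖ ^ 2 - ε) - 2 * ρ * ‖w - x‖ * cos (φ - ψ)| := by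
  have h3 : inner ℝ (unitVec φ) (w - z) - inner ℝ (unitVec φ) (x - z) =
      ‖w - x‖ * cos (φ - ψ) := by
    rw [← inner_sub_right, sub_sub_sub_cancel_right, ← inner_unitVec, ← real_inner_smul_right,
      ← hψ]
  rw [logKernel, norm_sub_rev x, norm_add_smul_unitVec_sub_sq, norm_add_smul_unitVec_sub_sq]
  congr 2
  linear_combination -2 * ρ * h3

lemma integral_log_abs_sub_mul_cos_sub (α β ψ : ℝ) :
    ∫ φ in (0 : ℝ)..(2 * π), log |α - β * cos (φ - ψ)| =
      ∫ φ in (0 : ℝ)..(2 * π), log |α - β * cos φ| := by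
  have hp : Function.Periodic (fun φ => log |α - β * cos φ|) (2 * π) := fun φ => by
    simp only [cos_add_two_pi]
  rw [intervalIntegral.integral_comp_sub_right (fun φ => log |α - β * cos φ|) ψ]
  have h := hp.intervalIntegral_add_eq (0 - ψ) 0
  rwa [zero_add, show 0 - ψ + 2 * π = 2 * π - ψ by ring] at h

/-- The integral of the logarithmic kernel over the circle. -/
lemma exists_integral_logKernel_eq (z : EuclideanSpace ℝ (Fin 2)) (ρ : ℝ) :
    ∃ c : ℝ, 0 ≤ c ∧ ∀ x w ε, ∫ y, logKernel x ε y w ∂(circleSurfaceMeasure z ρ) =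
      c * ∫ φ in (0 : ℝ)..(2 * π),
        log |(‖w - z‖ ^ 2 - ‖x - z‖ ^ 2 - ε) - 2 * ρ * ‖w - x‖ * cos φ| := by
  obtain ⟨c, hc⟩ := exists_circleSurfaceMeasure_eq z ρ
  refine ⟨c, c.coe_nonneg, fun x w ε => ?_⟩
  obtain ⟨ψ, -, hψ⟩ := exists_eq_norm_smul_unitVec (w - x)
  rw [hc, integral_smul_nnreal_measure, integral_map
    (by fun_prop : Continuous fun φ => z + ρ • unitVec φ).aemeasurable
    (measurable_logKernel_left x ε w).aestronglyMeasurable, NNReal.smul_def, smul_eq_mul,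
    ← integral_log_abs_sub_mul_cos_sub _ _ ψ, intervalIntegral.integral_of_le (by positivity)]
  simp only [logKernel_circle ε hψ]

/-- The integral of the logarithmic kernel over the circle does not change to first order in `ε`. -/
lemma exists_integral_logKernel_sub_bound (hρ : 0 < ρ) (hx : x ∈ Metric.ball z ρ) :
    ∃ K : ℝ, 0 ≤ K ∧ ∀ w ∈ Metric.ball z ρ, w ≠ x → ∀ ε, 0 ≤ ε →
      (ε ≤ (ρ - ‖x - z‖) * ‖w - x‖ → ∫ y, logKernel x 0 y w ∂(circleSurfaceMeasure z ρ) -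
        ∫ y, logKernel x ε y w ∂(circleSurfaceMeasure z ρ) = 0) ∧
      |∫ y, logKernel x 0 y w ∂(circleSurfaceMeasure z ρ) -
        ∫ y, logKernel x ε y w ∂(circleSurfaceMeasure z ρ)| ≤ ε * (K / ‖w - x‖) := by
  obtain ⟨c, hc, h⟩ := exists_integral_logKernel_eq z ρ
  rw [mem_ball_iff_norm] at hx
  set δ := ρ - ‖x - z‖ with hδ
  have hδ0 : 0 < δ := sub_pos.2 hx
  -- Only ε > δd with d = ‖w - x‖ needs a bound. There 1 < ε/(δd), so |α - ε|/(2ρd) ≤ 1 + ε/(2ρd) ≤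
  -- (ε/d)(1/δ + 1/(2ρ)).
  refine ⟨c * (8 * π) * (1 / δ + 1 / (2 * ρ)), by positivity, fun w hw hwx ε hε => ?_⟩
  rw [mem_ball_iff_norm] at hw
  have hd : 0 < ‖w - x‖ := norm_pos_iff.2 (sub_ne_zero.2 hwx)
  set d := ‖w - x‖ with hdd
  set α := ‖w - z‖ ^ 2 - ‖x - z‖ ^ 2 with hα
  have hβ : 0 < 2 * ρ * d := by positivity
  have htri1 : ‖w - z‖ ≤ d + ‖x - z‖ := by
    simpa using norm_add_le (w - x) (x - z)
  have htri2 : ‖x - z‖ ≤ d + ‖w - z‖ := by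
    have := norm_add_le (x - w) (w - z)
    rw [norm_sub_rev x w] at this
    simpa using this
  -- Factor α as a difference of squares: the difference of the norms is at most d, and their sum is
  -- at most ρ + (ρ - δ). The gap δd to β is the room for ε.
  have hα1 : |α| ≤ (2 * ρ - δ) * d := by
    rw [hα, abs_le]
    constructor <;> nlinarith [norm_nonneg (w - z), norm_nonneg (x - z)]
  have hαβ : |α| ≤ 2 * ρ * d := hα1.trans (by nlinarith)
  have h0 := h x w 0
  rw [sub_zero, ← hα, integral_log_abs_sub_mul_cos_of_le hβ hαβ] at h0
  have hε' := h x w ε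
  rw [← hα] at hε'
  have hαε : |α - ε| ≤ |α| + ε := (abs_sub _ _).trans (by rw [abs_of_nonneg hε])
  have hzero : ε ≤ δ * d → ∫ y, logKernel x 0 y w ∂(circleSurfaceMeasure z ρ) -
        ∫ y, logKernel x ε y w ∂(circleSurfaceMeasure z ρ) = 0 := fun hle => by
    rw [h0, hε', integral_log_abs_sub_mul_cos_of_le hβ (by nlinarith), sub_self]
  refine ⟨hzero, ?_⟩
  rcases le_or_gt ε (δ * d) with hle | hlt
  · rw [hzero hle, abs_zero]
    positivity
  · rw [h0, hε', ← mul_sub, abs_mul, abs_of_nonneg hc, abs_sub_comm]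
    have hb := abs_integral_log_abs_sub_mul_cos_sub_le (α := α - ε) hβ
    have h1 : |α - ε| / (2 * ρ * d) ≤ ε / (δ * d) + ε / (2 * ρ * d) := by
      calc |α - ε| / (2 * ρ * d) ≤ (2 * ρ * d + ε) / (2 * ρ * d) := by
            gcongr; linarith
        _ = 1 + ε / (2 * ρ * d) := by rw [add_div, div_self hβ.ne']
        _ ≤ _ := by
            gcongr
            rw [le_div_iff₀ (by positivity)]
            linarith
    calc _ ≤ c * (8 * π * (ε / (δ * d) + ε / (2 * ρ * d))) := by
          gcongr
          exact hb.trans (by gcongr)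
      _ = _ := by field_simp

end LogKernel

/-! ### From wave integrals to the logarithmic kernel, and the limit ε → 0⁺. -/

section SingleLayer

variable {f : EuclideanSpace ℝ (Fin 2) → ℝ} {u : EuclideanSpace ℝ (Fin 2) → ℝ → ℝ}
  {z x : EuclideanSpace ℝ (Fin 2)} {ρ : ℝ}

lemma IsWaveSolution.continuousOn_time (hu : IsWaveSolution f (fun _ => 0) u)
    (y : EuclideanSpace ℝ (Fin 2)) : ContinuousOn (u y) (Ioi 0) := by
  have h : Continuous fun t : ℝ => u y (max t 0) :=
    hu.continuous_max.comp (by fun_prop : Continuous fun t : ℝ => (y, t))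
  refine h.continuousOn.congr fun t ht => ?_
  simp only [max_eq_left (mem_Ioi.1 ht).le]

/-- On the circle enclosing the support of the initial value, the wave decays in time. -/
lemma IsWaveSolution.exists_abs_le_div (hρ : 0 < ρ) (hf : ContDiff ℝ ∞ f)
    (hfc : HasCompactSupport f) (hfs : tsupport f ⊆ Metric.ball z ρ)
    (hu : IsWaveSolution f (fun _ => 0) u) :
    ∃ C : ℝ, 0 ≤ C ∧ ∀ y ∈ Metric.sphere z ρ, ∀ t, 0 < t → |u y t| ≤ C / t := by
  obtain ⟨M₀, hM₀⟩ := hf.continuous.bounded_above_of_compact_support hfc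
  obtain ⟨M₁, hM₁⟩ := (hf.continuous_fderiv (by simp)).bounded_above_of_compact_support
    (hfc.fderiv (𝕜 := ℝ))
  have hM₀' : 0 ≤ M₀ := (norm_nonneg _).trans (hM₀ 0)
  have hM₁' : 0 ≤ M₁ := (norm_nonneg _).trans (hM₁ 0)
  refine ⟨π ^ 2 * (2 * ρ * (M₀ + 2 * ρ * M₁)) / (2 * π), by positivity, fun y hy t ht => ?_⟩
  have h := hu.abs_le_div (by positivity) hM₀ hM₁ y
    (fun s φ hs => add_smul_unitVec_notMem_tsupport hfs hy φ hs) ht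
  rw [abs_mul, abs_of_pos two_pi_pos] at h
  rw [div_right_comm, le_div_iff₀ two_pi_pos, mul_comm]
  exact h

/-- The pairing of the wave with a difference of kernels as an integral over the initial value. -/
lemma IsWaveSolution.integral_sqrt_sub_sqrt_mul (hρ : 0 < ρ) (hf : ContDiff ℝ ∞ f)
    (hfc : HasCompactSupport f) (hfs : tsupport f ⊆ Metric.ball z ρ)
    (hu : IsWaveSolution f (fun _ => 0) u) (hx : x ∈ Metric.ball z ρ)
    {y : EuclideanSpace ℝ (Fin 2)} (hy : y ∈ Metric.sphere z ρ) {ε : ℝ} (hε : 0 ≤ ε) :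
    ∫ t in Ioi ‖x - y‖, (2 * √(t ^ 2 - ‖x - y‖ ^ 2) - 2 * √(t ^ 2 - √(‖x - y‖ ^ 2 + ε) ^ 2)) *
      (2 * π * u y t) = ∫ w, f w * (logKernel x 0 y w - logKernel x ε y w) := by
  obtain ⟨M₀, hM₀⟩ := hf.continuous.bounded_above_of_compact_support hfc
  obtain ⟨C, hC, huC⟩ := hu.exists_abs_le_div hρ hf hfc hfs
  have hout := fun s φ (hs : 2 * ρ < s) => add_smul_unitVec_notMem_tsupport hfs hy φ hs
  have ha : 0 < ‖x - y‖ := by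
    have := (norm_sub_le_of_mem hx hy).2
    rw [mem_ball_iff_norm] at hx
    linarith
  obtain ⟨h1, h1'⟩ := integral_mul_logKernel (x := x) hf.continuous hM₀ hfs hy le_rfl
  obtain ⟨h2, h2'⟩ := integral_mul_logKernel (x := x) hf.continuous hM₀ hfs hy hε
  have hi := fun b => (intervalIntegrable_iff_integrableOn_Ioc_of_le
    (by positivity : (0 : ℝ) ≤ 2 * ρ)).1 ((intervalIntegrable_log_abs_sq_sub b 0
      (2 * ρ)).continuousOn_mul
    (continuous_id.mul (continuous_angularIntegral hf.continuous y)).continuousOn)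
  have hright : ∫ w, f w * (logKernel x 0 y w - logKernel x ε y w) =
      ∫ s in Ioc 0 (2 * ρ), s * angularIntegral f y s *
        (log |s ^ 2 - ‖x - y‖ ^ 2| - log |s ^ 2 - √(‖x - y‖ ^ 2 + ε) ^ 2|) := by
    simp only [mul_sub]
    rw [integral_sub h1 h2, h1', h2', add_zero, sqrt_sq ha.le]
    exact (integral_sub (hi _) (hi _)).symm
  rw [hright]
  refine integral_sqrt_sub_sqrt_mul_eq_log (V := poissonPotential f y)
    (continuous_angularIntegral hf.continuous y) (fun s hs => ?_)
    (fun t ht => hu.hasDerivAt_poissonPotential hf y ht)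
    ((hu.continuousOn_time y).const_mul _ |>.congr fun t _ => rfl)
    (fun t ht => poissonPotential_eq f y ht) (C := 2 * π * C) (fun t ht => ?_)
    (fun t ht => abs_poissonPotential_le (by positivity) hM₀ y hout ht) ha ?_
  · rw [angularIntegral, intervalIntegral.integral_congr (g := fun _ => (0 : ℝ))
      fun φ _ => image_eq_zero_of_notMem_tsupport (hout s φ hs)]
    simp
  · rw [abs_mul, abs_of_pos two_pi_pos, mul_div_assoc]
    gcongr
    exact huC y hy t ht
  · exact le_sqrt_of_sq_le (by linarith)

/-- The wave integrals with a regularized kernel have a vanishing mean over the circle in the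
limit. -/
lemma tendsto_integral_logKernel_sub_div (hρ : 0 < ρ) (hf : ContDiff ℝ ∞ f)
    (hfc : HasCompactSupport f) (hfs : tsupport f ⊆ Metric.ball z ρ) (hx : x ∈ Metric.ball z ρ) :
    Tendsto (fun ε => ∫ y, (∫ w, f w * (logKernel x 0 y w - logKernel x ε y w)) / ε
      ∂(circleSurfaceMeasure z ρ)) (𝓝[>] 0) (𝓝 0) := by
  obtain ⟨M, hM⟩ := hf.continuous.bounded_above_of_compact_support hfc
  obtain ⟨K, hK, hb⟩ := exists_integral_logKernel_sub_bound hρ hx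
  set N : ℝ → EuclideanSpace ℝ (Fin 2) → ℝ := fun ε w =>
    f w * (∫ y, logKernel x 0 y w ∂(circleSurfaceMeasure z ρ) -
      ∫ y, logKernel x ε y w ∂(circleSurfaceMeasure z ρ)) / ε with hN
  have hswap : ∀ ε, 0 ≤ ε → Integrable (fun y => ∫ w, f w * logKernel x ε y w)
      (circleSurfaceMeasure z ρ) ∧ Integrable (fun w => f w *
        ∫ y, logKernel x ε y w ∂(circleSurfaceMeasure z ρ)) ∧
      ∫ y, (∫ w, f w * logKernel x ε y w) ∂(circleSurfaceMeasure z ρ) =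
      ∫ w, f w * ∫ y, logKernel x ε y w ∂(circleSurfaceMeasure z ρ) := fun ε hε => by
    have h := integrable_prod_mul_logKernel hρ hf.continuous hM hfs hx hε
    have h3 := integral_integral_swap h
    have h2 := h.integral_prod_right
    simp only [Function.uncurry, integral_const_mul] at h2 h3
    exact ⟨h.integral_prod_left, h2, h3⟩
  have hfub : ∀ ε, 0 < ε → ∫ y, (∫ w, f w * (logKernel x 0 y w - logKernel x ε y w)) / ε
      ∂(circleSurfaceMeasure z ρ) = ∫ w, N ε w := fun ε hε => by
    obtain ⟨a1, a2, a3⟩ := hswap 0 le_rfl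
    obtain ⟨b1, b2, b3⟩ := hswap ε hε.le
    rw [integral_div, hN]
    simp only [mul_sub]
    rw [integral_div, integral_sub a2 b2, ← a3, ← b3, ← integral_sub a1 b1]
    congr 1
    refine integral_congr_ae ?_
    filter_upwards [ae_mem_sphere_circleSurfaceMeasure z ρ] with y hy
    exact integral_sub (integral_mul_logKernel hf.continuous hM hfs hy le_rfl).1
      (integral_mul_logKernel hf.continuous hM hfs hy hε.le).1
  have hlim : Tendsto (fun ε => ∫ w, N ε w) (𝓝[>] 0) (𝓝 (∫ _ : EuclideanSpace ℝ (Fin 2), 0)) := by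
    -- The dominating function has a 1/‖x - w‖ singularity, integrable in the plane because the
    -- polar Jacobian cancels it.
    refine tendsto_integral_filter_of_dominated_convergence
      (fun w => ‖f w * (K * ‖x - w‖⁻¹)‖) ?_ ?_ ?_ ?_
    · filter_upwards [self_mem_nhdsWithin] with ε hε
      have := ((hswap 0 le_rfl).2.1.sub (hswap ε (mem_Ioi.1 hε).le).2.1).div_const ε
      refine this.aestronglyMeasurable.congr (ae_of_all _ fun w => ?_)
      simp only [hN, Pi.sub_apply, mul_sub]
    · filter_upwards [self_mem_nhdsWithin] with ε hε
      filter_upwards [Measure.ae_ne volume x] with w hw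
      have hε0 : 0 < ε := hε
      by_cases hfw : f w = 0
      · simp [hN, hfw]
      have hwb : w ∈ Metric.ball z ρ := hfs (subset_tsupport f hfw)
      have h1 := (hb w hwb hw ε hε0.le).2
      simp only [hN]
      rw [mul_div_assoc, norm_mul, norm_mul, norm_div, Real.norm_of_nonneg hε0.le]
      gcongr
      rw [div_le_iff₀ hε0, norm_mul, Real.norm_of_nonneg hK, norm_inv, norm_norm, norm_sub_rev x w]
      refine h1.trans (le_of_eq ?_)
      ring
    · refine (integrable_mul_radial hf.continuous hM x (R := ρ + ρ) (fun w hw => ?_)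
        (L := fun s => K * s⁻¹) ?_).norm
      · refine image_eq_zero_of_notMem_tsupport fun h => ?_
        have h1 := hfs h
        rw [mem_ball_iff_norm'] at h1
        rw [mem_ball_iff_norm] at hx
        have := norm_add_le (x - z) (z - w)
        rw [sub_add_sub_cancel] at this
        linarith
      · refine (integrableOn_const (C := K) (by simp) (by simp)).congr_fun
          (fun s hs => ?_) measurableSet_Ioc
        have := hs.1.ne'
        field_simp
    · filter_upwards [Measure.ae_ne volume x] with w hw
      by_cases hfw : f w = 0
      · simp [hN, hfw]
      have hwb : w ∈ Metric.ball z ρ := hfs (subset_tsupport f hfw)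
      have hd : 0 < (ρ - ‖x - z‖) * ‖w - x‖ :=
        mul_pos (sub_pos.2 (mem_ball_iff_norm.1 hx)) (norm_pos_iff.2 (sub_ne_zero.2 hw))
      -- For fixed w ≠ x the quotient is exactly 0 once ε ≤ (ρ - ‖x - z‖)‖w - x‖.
      refine tendsto_const_nhds.congr' ?_
      filter_upwards [Ioc_mem_nhdsGT hd] with ε hε
      simp only [hN]
      rw [(hb w hwb hw ε hε.1.le).1 hε.2, mul_zero, zero_div]
  rw [integral_zero] at hlim
  refine hlim.congr' ?_
  filter_upwards [self_mem_nhdsWithin] with ε hε using (hfub ε hε).symm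

/-- Measurability of time integrals of the wave with a kernel depending on the distance. -/
lemma IsWaveSolution.aestronglyMeasurable_integral (hu : IsWaveSolution f (fun _ => 0) u)
    (x : EuclideanSpace ℝ (Fin 2)) {k : ℝ → ℝ → ℝ} (hk : Measurable fun p : ℝ × ℝ => k p.1 p.2)
    (hk0 : ∀ a t, 0 < t → t ≤ a → k a t = 0)
    (μ : Measure (EuclideanSpace ℝ (Fin 2))) [SFinite μ] :
    AEStronglyMeasurable (fun y => ∫ t in Ioi ‖x - y‖, k ‖x - y‖ t * u y t) μ := by
  have h1 : Measurable fun p : EuclideanSpace ℝ (Fin 2) × ℝ =>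
      k ‖x - p.1‖ p.2 * u p.1 (max p.2 0) :=
    (hk.comp (by fun_prop : Measurable fun p : EuclideanSpace ℝ (Fin 2) × ℝ =>
      (‖x - p.1‖, p.2))).mul hu.continuous_max.measurable
  have h2 := (h1.stronglyMeasurable.integral_prod_right'
    (ν := volume.restrict (Ioi (0 : ℝ)))).aestronglyMeasurable (μ := μ)
  refine h2.congr (ae_of_all _ fun y => ?_)
  simp only
  -- Since the kernel vanishes for t ≤ ‖x - y‖, the y-dependent domain can be enlarged to (0, ∞),
  -- where measurability of parametric integrals applies.
  rw [← setIntegral_eq_of_subset_of_forall_sdiff_eq_zero measurableSet_Ioi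
    (Ioi_subset_Ioi (norm_nonneg (x - y)))]
  · refine setIntegral_congr_fun measurableSet_Ioi fun t ht => ?_
    simp only [max_eq_left (mem_Ioi.1 ht).le]
  · intro t ht
    rw [hk0 _ t ht.1 (not_lt.1 ht.2), zero_mul]

/-- The regularized kernels converge to the singular one. -/
lemma tendsto_sqrt_sub_sqrt_div {A : ℝ} (hA : 0 < A) :
    Tendsto (fun ε => (2 * √A - 2 * √(A - ε)) / ε) (𝓝[>] 0) (𝓝 (1 / √A)) := by
  have h1 : Tendsto (fun ε => 2 / (√A + √(A - ε))) (𝓝[>] 0) (𝓝 (1 / √A)) := by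
    have hs := sqrt_pos.2 hA
    have hc : ContinuousAt (fun ε => 2 / (√A + √(A - ε))) 0 :=
      continuousAt_const.div (by fun_prop) (by simp; positivity)
    have := hc.tendsto.mono_left (nhdsWithin_le_nhds (s := Ioi 0))
    rw [sub_zero, show 2 / (√A + √A) = 1 / √A by field_simp; ring] at this
    exact this
  refine h1.congr' ?_
  filter_upwards [Ioc_mem_nhdsGT hA] with ε hε
  have hs := sqrt_pos.2 hA
  have hs' := sqrt_nonneg (A - ε)
  rw [div_eq_div_iff (by positivity) hε.1.ne']
  nlinarith [sq_sqrt hA.le, sq_sqrt (sub_nonneg.2 hε.2)]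

end SingleLayer

/-! ### Removing the regularization. -/

section Assembly

variable {f : EuclideanSpace ℝ (Fin 2) → ℝ} {u : EuclideanSpace ℝ (Fin 2) → ℝ → ℝ}
  {z x : EuclideanSpace ℝ (Fin 2)} {ρ : ℝ}

/-- The bound is uniform in ε, so twice the singular kernel dominates all the regularized ones. -/
lemma abs_sqrt_sub_sqrt_div_le {a ε t : ℝ} (ha : 0 ≤ a) (hε : 0 < ε) (hat : a < t) :
    |(2 * √(t ^ 2 - a ^ 2) - 2 * √(t ^ 2 - √(a ^ 2 + ε) ^ 2)) / ε| ≤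
      2 * (1 / √(t ^ 2 - a ^ 2)) := by
  obtain ⟨h1, h2⟩ := sqrt_sub_sqrt_bounds ha (le_sqrt_of_sq_le (by linarith) : a ≤ √(a ^ 2 + ε)) hat
  rw [sq_sqrt (by positivity : 0 ≤ a ^ 2 + ε), add_sub_cancel_left] at h2
  rw [sq_sqrt (by positivity : 0 ≤ a ^ 2 + ε)] at h1 ⊢
  rw [← mul_sub, abs_of_nonneg (by positivity), div_le_iff₀ hε]
  calc _ ≤ 2 * (ε / √(t ^ 2 - a ^ 2)) := by gcongr
    _ = _ := by ring

section TimeIntegral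

variable {w : ℝ → ℝ} {C a : ℝ}

lemma norm_mul_le_inv_mul_sqrt (hwC : ∀ t, 0 < t → |w t| ≤ C / t) (ha : 0 < a) {κ : ℝ → ℝ}
    (hκ : ∀ t, a < t → |κ t| ≤ 2 * (1 / √(t ^ 2 - a ^ 2))) {t : ℝ} (ht : a < t) :
    ‖κ t * w t‖ ≤ 2 * C * (1 / (t * √(t ^ 2 - a ^ 2))) := by
  have ht0 := ha.trans ht
  rw [norm_mul, Real.norm_eq_abs, Real.norm_eq_abs]
  calc |κ t| * |w t| ≤ (2 * (1 / √(t ^ 2 - a ^ 2))) * (C / t) := by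
        gcongr
        exacts [hκ t ht, hwC t ht0]
    _ = _ := by field_simp

lemma norm_integral_mul_le_of_decay (hwC : ∀ t, 0 < t → |w t| ≤ C / t) (ha : 0 < a) {κ : ℝ → ℝ}
    (hκ : ∀ t, a < t → |κ t| ≤ 2 * (1 / √(t ^ 2 - a ^ 2))) :
    ‖∫ t in Ioi a, κ t * w t‖ ≤ 2 * C * (π / (2 * a)) := by
  rw [← (integrable_inv_mul_sqrt ha).2, ← integral_const_mul]
  refine norm_integral_le_of_norm_le ((integrable_inv_mul_sqrt ha).1.const_mul _) ?_
  filter_upwards [ae_restrict_mem measurableSet_Ioi] with t ht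
  exact norm_mul_le_inv_mul_sqrt hwC ha hκ ht

lemma tendsto_integral_sqrt_sub_sqrt_div (hw : ContinuousOn w (Ioi 0))
    (hwC : ∀ t, 0 < t → |w t| ≤ C / t) (ha : 0 < a) :
    Tendsto (fun ε => ∫ t in Ioi a,
      (2 * √(t ^ 2 - a ^ 2) - 2 * √(t ^ 2 - √(a ^ 2 + ε) ^ 2)) / ε * w t) (𝓝[>] 0)
      (𝓝 (∫ t in Ioi a, 1 / √(t ^ 2 - a ^ 2) * w t)) := by
  refine tendsto_integral_filter_of_dominated_convergence
    (fun t => 2 * C * (1 / (t * √(t ^ 2 - a ^ 2)))) ?_ ?_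
    ((integrable_inv_mul_sqrt ha).1.const_mul _) ?_
  · refine Eventually.of_forall fun ε => ContinuousOn.aestronglyMeasurable ?_ measurableSet_Ioi
    exact ContinuousOn.mul (by fun_prop) (hw.mono (Ioi_subset_Ioi ha.le))
  · filter_upwards [self_mem_nhdsWithin] with ε hε
    filter_upwards [ae_restrict_mem measurableSet_Ioi] with t ht
    exact norm_mul_le_inv_mul_sqrt hwC ha (fun t => abs_sqrt_sub_sqrt_div_le ha.le hε) ht
  · filter_upwards [ae_restrict_mem measurableSet_Ioi] with t ht
    refine Tendsto.mul_const _ ?_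
    refine (tendsto_sqrt_sub_sqrt_div (sq_lt_sq_of_nonneg ha.le ht)).congr' ?_
    filter_upwards [self_mem_nhdsWithin] with ε hε
    have hε0 : 0 < ε := hε
    rw [sq_sqrt (by positivity : 0 ≤ a ^ 2 + ε), sub_add_eq_sub_sub]

end TimeIntegral

/-- The regularized time integrals of the wave, averaged over the circle, vanish in the limit. -/
lemma IsWaveSolution.tendsto_integral_regularized (hρ : 0 < ρ) (hf : ContDiff ℝ ∞ f)
    (hfc : HasCompactSupport f) (hfs : tsupport f ⊆ Metric.ball z ρ)
    (hu : IsWaveSolution f (fun _ => 0) u) (hx : x ∈ Metric.ball z ρ) :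
    Tendsto (fun ε => ∫ y, (∫ t in Ioi ‖x - y‖,
      (2 * √(t ^ 2 - ‖x - y‖ ^ 2) - 2 * √(t ^ 2 - √(‖x - y‖ ^ 2 + ε) ^ 2)) / ε * u y t)
      ∂(circleSurfaceMeasure z ρ)) (𝓝[>] 0) (𝓝 0) := by
  have h := (tendsto_integral_logKernel_sub_div hρ hf hfc hfs hx).const_mul (2 * π)⁻¹
  rw [mul_zero] at h
  refine h.congr' ?_
  filter_upwards [self_mem_nhdsWithin] with ε hε
  rw [← integral_const_mul]
  refine integral_congr_ae ?_
  filter_upwards [ae_mem_sphere_circleSurfaceMeasure z ρ] with y hy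
  rw [← hu.integral_sqrt_sub_sqrt_mul hρ hf hfc hfs hx hy (mem_Ioi.1 hε).le, ← integral_div,
    ← integral_const_mul]
  refine integral_congr_ae (ae_of_all _ fun t => ?_)
  have := pi_pos.ne'
  simp only
  field_simp

lemma IsWaveSolution.integrable_and_integral_eq_zero (hρ : 0 < ρ) (hf : ContDiff ℝ ∞ f)
    (hfc : HasCompactSupport f) (hfs : tsupport f ⊆ Metric.ball z ρ)
    (hu : IsWaveSolution f (fun _ => 0) u) (hx : x ∈ Metric.ball z ρ) :
    Integrable (fun y => ∫ t in Ioi ‖x - y‖, 1 / √(t ^ 2 - ‖x - y‖ ^ 2) * u y t)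
      (circleSurfaceMeasure z ρ) ∧
    ∫ y, (∫ t in Ioi ‖x - y‖, 1 / √(t ^ 2 - ‖x - y‖ ^ 2) * u y t)
      ∂(circleSurfaceMeasure z ρ) = 0 := by
  obtain ⟨C, hC, huC⟩ := hu.exists_abs_le_div hρ hf hfc hfs
  have hδ : 0 < ρ - ‖x - z‖ := sub_pos.2 (mem_ball_iff_norm.1 hx)
  have hdist : ∀ y ∈ Metric.sphere z ρ, ρ - ‖x - z‖ ≤ ‖x - y‖ := fun y hy =>
    (norm_sub_le_of_mem hx hy).2
  have hsqrt : ∀ a t : ℝ, 0 < t → t ≤ a → ∀ b, a ^ 2 ≤ b → √(t ^ 2 - b) = 0 :=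
    fun a t ht hta b hb => sqrt_eq_zero_of_nonpos (by nlinarith)
  have hbound : ∀ y ∈ Metric.sphere z ρ, ∀ κ : ℝ → ℝ,
      (∀ t, ‖x - y‖ < t → |κ t| ≤ 2 * (1 / √(t ^ 2 - ‖x - y‖ ^ 2))) →
      ‖∫ t in Ioi ‖x - y‖, κ t * u y t‖ ≤ 2 * C * (π / (2 * (ρ - ‖x - z‖))) :=
    fun y hy κ hκ => (norm_integral_mul_le_of_decay (huC y hy)
      (hδ.trans_le (hdist y hy)) hκ).trans (by gcongr; exact hdist y hy)
  refine ⟨Integrable.of_bound (hu.aestronglyMeasurable_integral x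
    (k := fun a t => 1 / √(t ^ 2 - a ^ 2)) (by fun_prop) (fun a t ht hta => ?_) _)
    (2 * C * (π / (2 * (ρ - ‖x - z‖)))) ?_, ?_⟩
  · rw [hsqrt a t ht hta _ le_rfl, div_zero]
  · filter_upwards [ae_mem_sphere_circleSurfaceMeasure z ρ] with y hy
    refine hbound y hy _ fun t _ => ?_
    have := one_div_nonneg.2 (sqrt_nonneg (t ^ 2 - ‖x - y‖ ^ 2))
    rw [abs_of_nonneg this]
    linarith
  -- The regularized circle integrals tend both to the singular one, by dominated convergence with a
  -- constant bound on a finite measure, and to 0.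
  · refine tendsto_nhds_unique (tendsto_integral_filter_of_dominated_convergence
      (fun _ => 2 * C * (π / (2 * (ρ - ‖x - z‖)))) ?_ ?_ (integrable_const _) ?_)
      (hu.tendsto_integral_regularized hρ hf hfc hfs hx)
    · filter_upwards [self_mem_nhdsWithin] with ε hε
      have hε0 : 0 < ε := hε
      refine hu.aestronglyMeasurable_integral x (k := fun a t =>
        (2 * √(t ^ 2 - a ^ 2) - 2 * √(t ^ 2 - √(a ^ 2 + ε) ^ 2)) / ε) (by fun_prop)
        (fun a t ht hta => ?_) _
      rw [sq_sqrt (by positivity : 0 ≤ a ^ 2 + ε), hsqrt a t ht hta _ le_rfl,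
        hsqrt a t ht hta (a ^ 2 + ε) (by linarith), sub_self, zero_div]
    · filter_upwards [self_mem_nhdsWithin] with ε hε
      filter_upwards [ae_mem_sphere_circleSurfaceMeasure z ρ] with y hy
      exact hbound y hy _ fun t => abs_sqrt_sub_sqrt_div_le (norm_nonneg _) hε
    · filter_upwards [ae_mem_sphere_circleSurfaceMeasure z ρ] with y hy
      exact tendsto_integral_sqrt_sub_sqrt_div (hu.continuousOn_time y) (huC y hy)
        (hδ.trans_le (hdist y hy))

end Assembly

theorem lemma3p5 (ρ : ℝ) (hρ : 0 < ρ) (z : EuclideanSpace ℝ (Fin 2))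
    (f : EuclideanSpace ℝ (Fin 2) → ℝ) (hf : ContDiff ℝ ∞ f) (hfc : HasCompactSupport f)
    (hfs : tsupport f ⊆ Metric.ball z ρ)
    (u : EuclideanSpace ℝ (Fin 2) → ℝ → ℝ) (hu : IsWaveSolution f (fun _ => 0) u)
    (x : EuclideanSpace ℝ (Fin 2)) (hx : x ∈ Metric.ball z ρ) :
    (∀ y ∈ Metric.sphere z ρ,
      MeasureTheory.IntegrableOn (fun t : ℝ => u y t / √(t ^ 2 - ‖x - y‖ ^ 2))
        (Set.Ioi ‖x - y‖) MeasureTheory.volume) ∧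
    MeasureTheory.Integrable
      (fun y => ∫ t in Set.Ioi ‖x - y‖, u y t / √(t ^ 2 - ‖x - y‖ ^ 2))
      (circleSurfaceMeasure z ρ) ∧
    ∫ y, (∫ t in Set.Ioi ‖x - y‖, u y t / √(t ^ 2 - ‖x - y‖ ^ 2))
      ∂(circleSurfaceMeasure z ρ) = 0 := by
  refine ⟨fun y hy => ?_, ?_⟩
  · obtain ⟨C, -, huC⟩ := hu.exists_abs_le_div hρ hf hfc hfs
    exact integrableOn_div_sqrt (hu.continuousOn_time y) (huC y hy)
      ((sub_pos.2 (mem_ball_iff_norm.1 hx)).trans_le (norm_sub_le_of_mem hx hy).2)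
  · simpa only [one_div_mul_eq_div] using hu.integrable_and_integral_eq_zero hρ hf hfc hfs hx
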